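/- Let $A$ be a complex Banach algebra with unit, $E$ a complex Banach space, and $\tau : A \to E$ a continuous linear map which is tracial, i.e. $\tau(yx)=\tau(xy)$ for all $x,y\in A$. Extend $\tau$ to $M_\infty(A)=\bigcup_{n\ge1}M_n(A)$ (inclusions $x\mapsto \mathrm{diag}(x,0)$) by $\tau(x)=\sum_j\tau(x_{jj})$. Two idempotents $e,f\in M_\infty(A)$ are equivalent if $f=u^{-1}eu$ for some $n$ with $e,f\in M_n(A)$ and some $u\in GL_n(A)$, and stably equivalent if $e\oplus g$ and $f\oplus g$ are equivalent for some idempotent $g$. Let $K_0(A)$ be the Grothendieck group of the semigroup of stable equivalence classes $[e]$, with $[e]+[f]=[e\oplus f]$, and let $\underline\tau:K_0(A)\to E$ be the homomorphism with $\underline\tau([e])=\tau(e)$. Let $GL_\infty(A)=\bigcup_{n\ge1}GL_n(A)$ (inclusions $x\mapsto\mathrm{diag}(x,1)$) with the inductive limit topology, and let $GL_\infty^0(A)$ be the connected component of $1$ in it. For a piecewise differentiable path $\xi:[\alpha_1,\alpha_2]\to GL_\infty^0(A)$ (that is, a path with values in some $GL_n(A)$ which, as a path in the Banach space $M_n(A)$,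 is continuous, differentiable outside a finite set, and has an integrable derivative) put $$\widetilde\Delta_\tau(\xi)=\frac1{2\pi i}\int_{\alpha_1}^{\alpha_2}\tau\big(\dot\xi(\alpha)\xi(\alpha)^{-1}\big)\,d\alpha .$$ Then every $x\in GL_\infty^0(A)$ is the endpoint of such a path starting at $1$, and the class of $\widetilde\Delta_\tau(\xi)$ modulo $\underline\tau(K_0(A))$ is the same for all such paths $\xi$ from $1$ to $x$. Writing $\Delta_\tau(x)$ for this class, we obtain a well-defined map $$\Delta_\tau:GL_\infty^0(A)\to E/\underline\tau(K_0(A))$$ such that: (i) $\Delta_\tau$ is a homomorphism of groups, $\underline\tau(K_0(A))\subseteq\tau(A)$, and the image of $\Delta_\tau$ is $\tau(A)/\underline\tau(K_0(A))$; in particular, $\Delta_\tau$ is onto if $\tau$ is onto; (ii) for every $y\in M_\infty(A)$, the element $e^y$ belongs to $GL_\infty^0(A)$ and $\Delta_\tau(e^y)$ is the class of $\frac{1}{2\pi i}\tau(y)$ modulo $\underline\tau(K_0(A))$. -/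

import Mathlib

section KTheory
open Matrix

/-- The inclusion `M_n(R) → M_m(R)`, `x ↦ diag(x, 0)`, for `n ≤ m`. -/
def matPad {R : Type*} [Zero R] {n : ℕ} (m : ℕ) (x : Matrix (Fin n) (Fin n) R) :
    Matrix (Fin m) (Fin m) R :=
  Matrix.of fun i j =>
    if h : i.1 < n ∧ j.1 < n then x ⟨i.1, h.1⟩ ⟨j.1, h.2⟩ else 0

/-- The block sum `x ⊕ y = diag(x, y)`. -/
def matSum {R : Type*} [Zero R] {n m : ℕ} (x : Matrix (Fin n) (Fin n) R)
    (y : Matrix (Fin m) (Fin m) R) : Matrix (Fin (n + m)) (Fin (n + m)) R :=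
  Matrix.reindex finSumFinEquiv finSumFinEquiv (Matrix.fromBlocks x 0 0 y)

/-- Rectangular identity matrix, used to describe `matPad`. -/
def rectOne (R : Type*) [Zero R] [One R] (m n : ℕ) : Matrix (Fin m) (Fin n) R :=
  Matrix.of fun i j => if i.1 = j.1 then 1 else 0

theorem matPad_eq {R : Type*} [Ring R] {n : ℕ} (m : ℕ) (x : Matrix (Fin n) (Fin n) R) :
    matPad m x = rectOne R m n * x * rectOne R n m := by
  ext i j
  simp only [matPad, rectOne, Matrix.of_apply, Matrix.mul_apply, ite_mul, one_mul, zero_mul,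
    mul_ite, mul_one, mul_zero]
  by_cases hj : j.1 < n
  · rw [Finset.sum_eq_single (⟨j.1, hj⟩ : Fin n)]
    · by_cases hi : i.1 < n
      · rw [Finset.sum_eq_single (⟨i.1, hi⟩ : Fin n)]
        · simp [hi, hj]
        · intro b _ hb
          rw [if_neg]
          intro h
          exact hb (Fin.ext h.symm)
        · simp
      · simp only [hi, false_and, dite_false, if_true]
        rw [Finset.sum_eq_zero]
        intro b _
        rw [if_neg]
        intro h
        exact hi (h ▸ b.2)
    · intro b _ hb
      rw [if_neg]
      intro h
      exact hb (Fin.ext h)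
    · simp
  · rw [dif_neg (fun h => hj h.2), Finset.sum_eq_zero]
    intro b _
    rw [if_neg]
    intro h
    exact hj (h ▸ b.2)

theorem rectOne_mul {R : Type*} [Ring R] {n m k : ℕ} (h : n ≤ m ∨ k ≤ m) :
    rectOne R n m * rectOne R m k = rectOne R n k := by
  ext i j
  simp only [rectOne, Matrix.of_apply, Matrix.mul_apply, ite_mul, one_mul, zero_mul]
  by_cases hi : i.1 < m
  · rw [Finset.sum_eq_single (⟨i.1, hi⟩ : Fin m)]
    · simp
    · intro b _ hb
      rw [if_neg]
      intro h
      exact hb (Fin.ext h.symm)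
    · simp
  · rw [Finset.sum_eq_zero, if_neg]
    · rcases h with h | h <;> omega
    · intro b _
      rw [if_neg]
      omega

theorem rectOne_self (R : Type*) [Ring R] (n : ℕ) : rectOne R n n = 1 := by
  ext i j
  simp [rectOne, Matrix.one_apply, Fin.ext_iff]

theorem matPad_mul {R : Type*} [Ring R] {n m : ℕ} (h : n ≤ m) (x y : Matrix (Fin n) (Fin n) R) :
    matPad m (x * y) = matPad m x * matPad m y := by
  have := rectOne_mul (R := R) (n := n) (m := m) (k := n) (Or.inl h)
  rw [rectOne_self] at this
  simp only [matPad_eq, Matrix.mul_assoc]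
  rw [← Matrix.mul_assoc (rectOne R n m) (rectOne R m n), this, Matrix.one_mul]

theorem matPad_matPad {R : Type*} [Ring R] {n m k : ℕ} (h : n ≤ m)
    (x : Matrix (Fin n) (Fin n) R) : matPad k (matPad m x) = matPad k x := by
  simp only [matPad_eq, Matrix.mul_assoc]
  rw [rectOne_mul (Or.inl h), ← Matrix.mul_assoc (rectOne R k m),
    rectOne_mul (Or.inr h)]

theorem matPad_self {R : Type*} [Ring R] {n : ℕ}
    (x : Matrix (Fin n) (Fin n) R) : matPad n x = x := by
  simp [matPad_eq, rectOne_self]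

theorem matPad_add_eq {R : Type*} [Ring R] {n : ℕ} (m : ℕ) (x : Matrix (Fin n) (Fin n) R) :
    matPad (n + m) x = matSum x (0 : Matrix (Fin m) (Fin m) R) := by
  ext i j
  refine Fin.addCases (fun i => ?_) (fun i => ?_) i <;>
  refine Fin.addCases (fun j => ?_) (fun j => ?_) j <;>
  simp [matPad, matSum]

/-- An idempotent of `M_∞(R)`, given by an idempotent matrix of some finite size. -/
structure IdemMat (R : Type*) [Ring R] where
  size : ℕ
  mat : Matrix (Fin size) (Fin size) R
  idem : mat * mat = mat

/-- Two idempotents of `M_∞(R)` are equivalent if they are conjugate in some `M_N(R)` that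
contains both. -/
def IdemEquiv {R : Type*} [Ring R] (e f : IdemMat R) : Prop :=
  ∃ N : ℕ, e.size ≤ N ∧ f.size ≤ N ∧ ∃ u : (Matrix (Fin N) (Fin N) R)ˣ,
    matPad N f.mat = (u⁻¹).1 * matPad N e.mat * u.1

/-- Algebraic (Murray--von Neumann) equivalence; an auxiliary description of `IdemEquiv`. -/
def MvNEquiv {R : Type*} [Ring R] {m n : Type*} [Fintype m] [Fintype n]
    (e : Matrix m m R) (f : Matrix n n R) : Prop :=
  ∃ (a : Matrix m n R) (b : Matrix n m R), a * b = e ∧ b * a = f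

theorem MvNEquiv.symm {R : Type*} [Ring R] {m n : Type*} [Fintype m] [Fintype n]
    {e : Matrix m m R} {f : Matrix n n R} (h : MvNEquiv e f) : MvNEquiv f e := by
  obtain ⟨a, b, h1, h2⟩ := h
  exact ⟨b, a, h2, h1⟩

theorem MvNEquiv.trans {R : Type*} [Ring R] {m n k : Type*} [Fintype m] [Fintype n] [Fintype k]
    {e : Matrix m m R} {f : Matrix n n R} {g : Matrix k k R} (he : e * e = e) (hg : g * g = g)
    (h : MvNEquiv e f) (h' : MvNEquiv f g) : MvNEquiv e g := by
  obtain ⟨a, b, h1, h2⟩ := h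
  obtain ⟨c, d, h3, h4⟩ := h'
  refine ⟨a * c, d * b, ?_, ?_⟩
  · calc a * c * (d * b) = a * (c * d) * b := by simp only [Matrix.mul_assoc]
      _ = (a * b) * (a * b) := by rw [h3, ← h2]; simp only [Matrix.mul_assoc]
      _ = e := by rw [h1, he]
  · calc d * b * (a * c) = d * (b * a) * c := by simp only [Matrix.mul_assoc]
      _ = (d * c) * (d * c) := by rw [h2, ← h3]; simp only [Matrix.mul_assoc]
      _ = g := by rw [h4, hg]

theorem mvnEquiv_matPad {R : Type*} [Ring R] {n N : ℕ} (h : n ≤ N) (e : Matrix (Fin n) (Fin n) R)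
    (he : e * e = e) : MvNEquiv e (matPad N e) := by
  have := rectOne_mul (R := R) (n := n) (m := N) (k := n) (Or.inl h)
  rw [rectOne_self] at this
  refine ⟨e * rectOne R n N, rectOne R N n * e, ?_, ?_⟩
  · rw [Matrix.mul_assoc, ← Matrix.mul_assoc (rectOne R n N), this, Matrix.one_mul, he]
  · rw [matPad_eq, Matrix.mul_assoc, ← Matrix.mul_assoc e, he, Matrix.mul_assoc]

theorem mvnEquiv_reindex {R : Type*} [Ring R] {m n : Type*} [Fintype m] [Fintype n]
    (s : m ≃ n) (e : Matrix m m R) (he : e * e = e) :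
    MvNEquiv e (Matrix.reindex s s e) := by
  refine ⟨e.submatrix id s.symm, e.submatrix s.symm id, ?_, ?_⟩
  · rw [Matrix.submatrix_mul_equiv, he, Matrix.submatrix_id_id]
  · rw [← Matrix.submatrix_mul e e s.symm id s.symm Function.bijective_id, he,
      Matrix.reindex_apply]

theorem IdemEquiv.mvnEquiv {R : Type*} [Ring R] {e f : IdemMat R} (h : IdemEquiv e f) :
    MvNEquiv e.mat f.mat := by
  obtain ⟨N, h1, h2, u, hu⟩ := h
  have pe := matPad_mul h1 e.mat e.mat
  have pf := matPad_mul h2 f.mat f.mat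
  rw [e.idem] at pe
  rw [f.idem] at pf
  refine (mvnEquiv_matPad h1 e.mat e.idem).trans e.idem f.idem ?_
  refine MvNEquiv.trans (f := matPad N f.mat) pe.symm f.idem ?_
    (mvnEquiv_matPad h2 f.mat f.idem).symm
  refine ⟨matPad N e.mat * u.1, (u⁻¹).1 * matPad N e.mat, ?_, ?_⟩
  · rw [Matrix.mul_assoc, ← Matrix.mul_assoc u.1, Units.mul_inv, Matrix.one_mul, ← pe]
  · rw [hu, Matrix.mul_assoc, ← Matrix.mul_assoc (matPad N e.mat), ← pe, Matrix.mul_assoc]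

theorem MvNEquiv.idemEquiv {R : Type*} [Ring R] {e f : IdemMat R} (h : MvNEquiv e.mat f.mat) :
    IdemEquiv e f := by
  let N := e.size + f.size
  have h1 : e.size ≤ N := Nat.le_add_right _ _
  have h2 : f.size ≤ N := Nat.le_add_left _ _
  have pe := matPad_mul h1 e.mat e.mat
  have pf := matPad_mul h2 f.mat f.mat
  rw [e.idem] at pe
  rw [f.idem] at pf
  have h3 : MvNEquiv (matPad N e.mat) (matPad N f.mat) :=
    ((mvnEquiv_matPad h1 e.mat e.idem).symm.trans pe.symm f.idem h).trans pe.symm pf.symm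
      (mvnEquiv_matPad h2 f.mat f.idem)
  refine ⟨N + N, by omega, by omega, ?_⟩
  rw [← matPad_matPad h1 e.mat, ← matPad_matPad h2 f.mat]
  generalize matPad N e.mat = X at *
  generalize matPad N f.mat = Y at *
  obtain ⟨a', b', hab', hba'⟩ := h3
  obtain ⟨a, b, hab, hba, hXa, haY, hYb, hbX⟩ : ∃ a b : Matrix (Fin N) (Fin N) R,
      a * b = X ∧ b * a = Y ∧ X * a = a ∧ a * Y = a ∧ Y * b = b ∧ b * X = b := by
    refine ⟨X * a' * Y, Y * b' * X, ?_, ?_, ?_, ?_, ?_, ?_⟩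
    · calc X * a' * Y * (Y * b' * X) = X * a' * (Y * Y) * b' * X := by noncomm_ring
        _ = X * (a' * b') * (a' * b') * X := by rw [← pf, ← hba']; noncomm_ring
        _ = X := by rw [hab', ← pe, ← pe, ← pe]
    · calc Y * b' * X * (X * a' * Y) = Y * b' * (X * X) * a' * Y := by noncomm_ring
        _ = Y * (b' * a') * (b' * a') * Y := by rw [← pe, ← hab']; noncomm_ring
        _ = Y := by rw [hba', ← pf, ← pf, ← pf]
    · rw [← mul_assoc, ← mul_assoc, ← pe]
    · rw [mul_assoc, ← pf]
    · rw [← mul_assoc, ← mul_assoc, ← pf]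
    · rw [mul_assoc, ← pe]
  let w : Matrix (Fin N ⊕ Fin N) (Fin N ⊕ Fin N) R := Matrix.fromBlocks (1 - X) a b (1 - Y)
  let s : Matrix (Fin N ⊕ Fin N) (Fin N ⊕ Fin N) R := Matrix.fromBlocks 0 1 1 0
  have hs : s * s = 1 := by
    simp [s, Matrix.fromBlocks_multiply]
  have hw : w * w = 1 := by
    simp only [w, Matrix.fromBlocks_multiply]
    rw [← Matrix.fromBlocks_one]
    congr 1
    · rw [sub_mul, mul_sub, mul_sub, ← pe, hab]; simp
    · rw [sub_mul, mul_sub, hXa, haY]; simp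
    · rw [sub_mul, mul_sub, hYb, hbX]; simp
    · rw [sub_mul, mul_sub, mul_sub, ← pf, hba]; simp
  have hmain : Matrix.fromBlocks Y 0 0 0 = s * w * Matrix.fromBlocks X 0 0 0 * (w * s) := by
    simp only [w, s, Matrix.fromBlocks_multiply]
    congr 1 <;> simp [mul_sub, sub_mul, ← pe, hbX, hba]
  let r := Matrix.reindexAlgEquiv ℤ R (finSumFinEquiv (m := N) (n := N))
  refine ⟨⟨r (w * s), r (s * w), ?_, ?_⟩, ?_⟩
  · rw [← map_mul, mul_assoc, ← mul_assoc s, hs, one_mul, hw, map_one]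
  · rw [← map_mul, mul_assoc, ← mul_assoc w, hw, one_mul, hs, map_one]
  · rw [matPad_add_eq, matPad_add_eq]
    change r (Matrix.fromBlocks Y 0 0 0) = r (s * w) * r (Matrix.fromBlocks X 0 0 0) * r (w * s)
    rw [hmain, map_mul, map_mul]


theorem matSum_mul {R : Type*} [Ring R] {n m : ℕ} (x x' : Matrix (Fin n) (Fin n) R)
    (y y' : Matrix (Fin m) (Fin m) R) :
    matSum x y * matSum x' y' = matSum (x * x') (y * y') := by
  simp only [matSum, Matrix.reindex_apply, Matrix.submatrix_mul_equiv, Matrix.fromBlocks_multiply]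
  simp

/-- The block sum `e ⊕ f` of two idempotents. -/
def IdemMat.sum {R : Type*} [Ring R] (e f : IdemMat R) : IdemMat R where
  size := e.size + f.size
  mat := matSum e.mat f.mat
  idem := by rw [matSum_mul, e.idem, f.idem]

/-- The zero idempotent. -/
def IdemMat.zero (R : Type*) [Ring R] : IdemMat R where
  size := 0
  mat := 0
  idem := by simp

/-- Two idempotents `e`, `f` are stably equivalent if `e ⊕ g` and `f ⊕ g` are equivalent for
some idempotent `g`. -/
def StablyEquiv {R : Type*} [Ring R] (e f : IdemMat R) : Prop :=
  ∃ g : IdemMat R, IdemEquiv (e.sum g) (f.sum g)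

theorem idemEquiv_iff {R : Type*} [Ring R] {e f : IdemMat R} :
    IdemEquiv e f ↔ MvNEquiv e.mat f.mat := ⟨fun h => h.mvnEquiv, fun h => h.idemEquiv⟩

theorem IdemEquiv.refl {R : Type*} [Ring R] (e : IdemMat R) : IdemEquiv e e :=
  idemEquiv_iff.2 ⟨e.mat, e.mat, e.idem, e.idem⟩

theorem IdemEquiv.symm {R : Type*} [Ring R] {e f : IdemMat R} (h : IdemEquiv e f) :
    IdemEquiv f e := idemEquiv_iff.2 (idemEquiv_iff.1 h).symm

theorem IdemEquiv.trans {R : Type*} [Ring R] {e f g : IdemMat R} (h : IdemEquiv e f)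
    (h' : IdemEquiv f g) : IdemEquiv e g :=
  idemEquiv_iff.2 ((idemEquiv_iff.1 h).trans e.idem g.idem (idemEquiv_iff.1 h'))

/-- Rectangular block sum. -/
def rectSum {R : Type*} [Zero R] {n m n' m' : ℕ} (x : Matrix (Fin n) (Fin n') R)
    (y : Matrix (Fin m) (Fin m') R) : Matrix (Fin (n + m)) (Fin (n' + m')) R :=
  Matrix.reindex finSumFinEquiv finSumFinEquiv (Matrix.fromBlocks x 0 0 y)

theorem rectSum_mul {R : Type*} [Ring R] {n m n' m' : ℕ}
    (x : Matrix (Fin n) (Fin n') R) (y : Matrix (Fin m) (Fin m') R)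
    (z : Matrix (Fin n') (Fin n) R) (w : Matrix (Fin m') (Fin m) R) :
    rectSum x y * rectSum z w = matSum (x * z) (y * w) := by
  simp only [rectSum, matSum, Matrix.reindex_apply, Matrix.submatrix_mul_equiv,
    Matrix.fromBlocks_multiply]
  simp

theorem IdemEquiv.sum {R : Type*} [Ring R] {e e' f f' : IdemMat R} (h : IdemEquiv e e')
    (h' : IdemEquiv f f') : IdemEquiv (e.sum f) (e'.sum f') := by
  obtain ⟨a, b, h1, h2⟩ := idemEquiv_iff.1 h
  obtain ⟨c, d, h3, h4⟩ := idemEquiv_iff.1 h'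
  refine idemEquiv_iff.2 ⟨rectSum a c, rectSum b d, ?_, ?_⟩
  · exact (rectSum_mul a c b d).trans (by rw [h1, h3]; rfl)
  · exact (rectSum_mul b d a c).trans (by rw [h2, h4]; rfl)

/-- Idempotents that differ by a permutation of the coordinates are equivalent. -/
theorem idemEquiv_of_reindex {R : Type*} [Ring R] {e f : IdemMat R} (s : Fin e.size ≃ Fin f.size)
    (h : ∀ i j, e.mat i j = f.mat (s i) (s j)) : IdemEquiv e f := by
  have h' : Matrix.reindex s s e.mat = f.mat := by
    ext i j
    simp [h]
  exact idemEquiv_iff.2 (h' ▸ mvnEquiv_reindex s e.mat e.idem)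

theorem matSum_swap {R : Type*} [Zero R] {n m : ℕ} (x : Matrix (Fin n) (Fin n) R)
    (y : Matrix (Fin m) (Fin m) R) (i j : Fin (n + m)) :
    matSum x y i j = matSum y x (finAddFlip i) (finAddFlip j) := by
  refine Fin.addCases (fun i => ?_) (fun i => ?_) i <;>
  refine Fin.addCases (fun j => ?_) (fun j => ?_) j <;>
  simp [matSum]

theorem matSum_assoc {R : Type*} [Zero R] {n m k : ℕ} (x : Matrix (Fin n) (Fin n) R)
    (y : Matrix (Fin m) (Fin m) R) (z : Matrix (Fin k) (Fin k) R) (i j : Fin (n + m + k)) :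
    matSum (matSum x y) z i j =
      matSum x (matSum y z) (finCongr (Nat.add_assoc n m k) i)
        (finCongr (Nat.add_assoc n m k) j) := by
  have c1 : ∀ i : Fin n, finCongr (Nat.add_assoc n m k)
      (Fin.castAdd k (Fin.castAdd m i)) = Fin.castAdd (m + k) i := fun i => rfl
  have c2 : ∀ i : Fin m, finCongr (Nat.add_assoc n m k)
      (Fin.castAdd k (Fin.natAdd n i)) = Fin.natAdd n (Fin.castAdd k i) := fun i => rfl
  have c3 : ∀ i : Fin k, finCongr (Nat.add_assoc n m k)
      (Fin.natAdd (n + m) i) = Fin.natAdd n (Fin.natAdd m i) :=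
    fun i => Fin.ext (Nat.add_assoc _ _ _)
  refine Fin.addCases (fun i => Fin.addCases (fun i => ?_) (fun i => ?_) i) (fun i => ?_) i <;>
  refine Fin.addCases (fun j => Fin.addCases (fun j => ?_) (fun j => ?_) j) (fun j => ?_) j <;>
  simp only [c1, c2, c3] <;> simp [matSum]

theorem matSum_zero {R : Type*} [Zero R] {n : ℕ} (x : Matrix (Fin n) (Fin n) R)
    (y : Matrix (Fin 0) (Fin 0) R) (i j : Fin (n + 0)) :
    matSum x y i j = x (finCongr (Nat.add_zero n) i) (finCongr (Nat.add_zero n) j) := by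
  have c1 : ∀ i : Fin n, finCongr (Nat.add_zero n) (Fin.castAdd 0 i) = i := fun i => rfl
  refine Fin.addCases (fun i => ?_) (fun i => i.elim0) i
  refine Fin.addCases (fun j => ?_) (fun j => j.elim0) j
  rw [c1, c1]
  simp only [matSum, Matrix.reindex_apply, Matrix.submatrix_apply,
    finSumFinEquiv_symm_apply_castAdd, Matrix.fromBlocks_apply₁₁]

theorem IdemMat.sum_comm {R : Type*} [Ring R] (e f : IdemMat R) :
    IdemEquiv (e.sum f) (f.sum e) :=
  idemEquiv_of_reindex (e := e.sum f) (f := f.sum e) finAddFlip (matSum_swap e.mat f.mat)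

theorem IdemMat.sum_assoc {R : Type*} [Ring R] (e f g : IdemMat R) :
    IdemEquiv ((e.sum f).sum g) (e.sum (f.sum g)) :=
  idemEquiv_of_reindex (e := (e.sum f).sum g) (f := e.sum (f.sum g))
    (finCongr (Nat.add_assoc _ _ _)) (matSum_assoc e.mat f.mat g.mat)

theorem IdemMat.sum_zero {R : Type*} [Ring R] (e : IdemMat R) :
    IdemEquiv (e.sum (IdemMat.zero R)) e :=
  idemEquiv_of_reindex (e := e.sum (IdemMat.zero R)) (f := e)
    (finCongr (Nat.add_zero _)) (matSum_zero e.mat _)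

theorem IdemEquiv.stablyEquiv {R : Type*} [Ring R] {e f : IdemMat R} (h : IdemEquiv e f) :
    StablyEquiv e f := ⟨IdemMat.zero R, h.sum (IdemEquiv.refl _)⟩

theorem IdemMat.sum_sum_comm {R : Type*} [Ring R] (e f g h : IdemMat R) :
    IdemEquiv ((e.sum f).sum (g.sum h)) ((e.sum g).sum (f.sum h)) := by
  refine (IdemMat.sum_assoc _ _ _).trans (IdemEquiv.trans ?_ (IdemMat.sum_assoc _ _ _).symm)
  refine (IdemEquiv.refl e).sum ?_
  refine (IdemMat.sum_assoc _ _ _).symm.trans (IdemEquiv.trans ?_ (IdemMat.sum_assoc _ _ _))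
  exact (IdemMat.sum_comm _ _).sum (IdemEquiv.refl h)

theorem StablyEquiv.sum {R : Type*} [Ring R] {e e' f f' : IdemMat R} (h : StablyEquiv e e')
    (h' : StablyEquiv f f') : StablyEquiv (e.sum f) (e'.sum f') := by
  obtain ⟨g, hg⟩ := h
  obtain ⟨k, hk⟩ := h'
  exact ⟨g.sum k, (IdemMat.sum_sum_comm _ _ _ _).trans
    ((hg.sum hk).trans (IdemMat.sum_sum_comm _ _ _ _))⟩

theorem StablyEquiv.trans {R : Type*} [Ring R] {e f g : IdemMat R} (h : StablyEquiv e f)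
    (h' : StablyEquiv f g) : StablyEquiv e g := by
  obtain ⟨k, hk⟩ := h
  obtain ⟨l, hl⟩ := h'
  refine ⟨k.sum l, ?_⟩
  have h1 : IdemEquiv ((e.sum k).sum l) ((f.sum k).sum l) := hk.sum (IdemEquiv.refl l)
  have h2 : IdemEquiv ((f.sum l).sum k) ((g.sum l).sum k) := hl.sum (IdemEquiv.refl k)
  have sw : ∀ x y z : IdemMat R, IdemEquiv ((x.sum y).sum z) ((x.sum z).sum y) := fun x y z =>
    (IdemMat.sum_assoc _ _ _).trans (((IdemEquiv.refl x).sum (IdemMat.sum_comm _ _)).trans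
      (IdemMat.sum_assoc _ _ _).symm)
  exact (IdemMat.sum_assoc _ _ _).symm.trans (h1.trans ((sw _ _ _).trans (h2.trans
    ((sw _ _ _).trans (IdemMat.sum_assoc _ _ _)))))

/-- Stable equivalence of idempotents of `M_∞(R)`, as a setoid. -/
instance stableSetoid (R : Type*) [Ring R] : Setoid (IdemMat R) where
  r := StablyEquiv
  iseqv :=
    { refl := fun e => (IdemEquiv.refl e).stablyEquiv
      symm := fun ⟨g, hg⟩ => ⟨g, hg.symm⟩
      trans := StablyEquiv.trans }

/-- Stable equivalence classes of idempotents of `M_∞(R)`. -/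
def StableClass (R : Type*) [Ring R] : Type _ := Quotient (stableSetoid R)

/-- Addition of stable equivalence classes, `[e] + [f] = [e ⊕ f]`. -/
instance StableClass.instAdd (R : Type*) [Ring R] : Add (StableClass R) where
  add := Quotient.map₂ IdemMat.sum fun _ _ h _ _ h' => StablyEquiv.sum h h'

instance StableClass.instZero (R : Type*) [Ring R] : Zero (StableClass R) where
  zero := Quotient.mk _ (IdemMat.zero R)

/-- The semigroup of stable equivalence classes, with `[e] + [f] = [e ⊕ f]`. -/
instance StableClass.instAddCommMonoid (R : Type*) [Ring R] : AddCommMonoid (StableClass R) where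
  add_assoc := by
    rintro ⟨a⟩ ⟨b⟩ ⟨c⟩
    exact Quotient.sound (IdemMat.sum_assoc a b c).stablyEquiv
  add_comm := by
    rintro ⟨a⟩ ⟨b⟩
    exact Quotient.sound (IdemMat.sum_comm a b).stablyEquiv
  zero_add := by
    rintro ⟨a⟩
    exact Quotient.sound ((IdemMat.sum_comm _ a).trans a.sum_zero).stablyEquiv
  add_zero := by
    rintro ⟨a⟩
    exact Quotient.sound a.sum_zero.stablyEquiv
  nsmul := nsmulRec

/-- The group `K₀(R)`: the Grothendieck group of the stable equivalence classes of idempotents. -/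
abbrev K0 (R : Type*) [Ring R] : Type _ := Algebra.GrothendieckAddGroup (StableClass R)

/-- The class `[e]` in `K₀(R)` of an idempotent `e`. -/
def K0.cls {R : Type*} [Ring R] (e : IdemMat R) : K0 R :=
  Algebra.GrothendieckAddGroup.of (Quotient.mk (stableSetoid R) e : StableClass R)

end KTheory

section Trace

/-- The extension of `τ : A → E` to matrices, `x ↦ ∑ⱼ τ(xⱼⱼ)`. -/
noncomputable def traceExt {A E : Type*} [NormedRing A] [NormedAlgebra ℂ A] [NormedAddCommGroup E]
    [NormedSpace ℂ E] (τ : A →L[ℂ] E) {n : Type*} [Fintype n] (x : Matrix n n A) : E :=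
  ∑ j, τ (x j j)

theorem traceExt_mul_comm {A E : Type*} [NormedRing A] [NormedAlgebra ℂ A] [NormedAddCommGroup E]
    [NormedSpace ℂ E] (τ : A →L[ℂ] E) (hτ : ∀ x y, τ (y * x) = τ (x * y)) {m n : Type*}
    [Fintype m] [Fintype n] (a : Matrix m n A) (b : Matrix n m A) :
    traceExt τ (a * b) = traceExt τ (b * a) := by
  simp only [traceExt, Matrix.mul_apply, map_sum]
  rw [Finset.sum_comm]
  exact Finset.sum_congr rfl fun _ _ => Finset.sum_congr rfl fun _ _ => hτ _ _

theorem traceExt_sum {A E : Type*} [NormedRing A] [NormedAlgebra ℂ A] [NormedAddCommGroup E]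
    [NormedSpace ℂ E] (τ : A →L[ℂ] E) (e f : IdemMat A) :
    traceExt τ (e.sum f).mat = traceExt τ e.mat + traceExt τ f.mat := by
  change ∑ j : Fin (e.size + f.size), τ (matSum e.mat f.mat j j) = _
  rw [Fin.sum_univ_add]
  simp [matSum, traceExt]

theorem traceExt_idemEquiv {A E : Type*} [NormedRing A] [NormedAlgebra ℂ A] [NormedAddCommGroup E]
    [NormedSpace ℂ E] (τ : A →L[ℂ] E) (hτ : ∀ x y, τ (y * x) = τ (x * y)) {e f : IdemMat A}
    (h : IdemEquiv e f) : traceExt τ e.mat = traceExt τ f.mat := by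
  obtain ⟨a, b, h1, h2⟩ := h.mvnEquiv
  rw [← h1, ← h2, traceExt_mul_comm τ hτ]

/-- The homomorphism `K₀(A) → E`, `[e] ↦ τ(e)`, induced by a tracial map `τ`. -/
noncomputable def traceK0 {A E : Type*} [NormedRing A] [NormedAlgebra ℂ A] [NormedAddCommGroup E]
    [NormedSpace ℂ E] (τ : A →L[ℂ] E) (hτ : ∀ x y, τ (y * x) = τ (x * y)) : K0 A →+ E :=
  Algebra.GrothendieckAddGroup.lift
    { toFun := Quotient.lift (fun e : IdemMat A => traceExt τ e.mat) (by
        rintro e f ⟨g, hg⟩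
        have := traceExt_idemEquiv τ hτ hg
        rw [traceExt_sum, traceExt_sum] at this
        exact add_right_cancel this)
      map_zero' := by
        change traceExt τ (IdemMat.zero A).mat = 0
        exact Finset.sum_empty
      map_add' := by
        rintro ⟨e⟩ ⟨f⟩
        exact traceExt_sum τ e f }

theorem traceK0_cls {A E : Type*} [NormedRing A] [NormedAlgebra ℂ A] [NormedAddCommGroup E]
    [NormedSpace ℂ E] (τ : A →L[ℂ] E) (hτ : ∀ x y, τ (y * x) = τ (x * y)) (e : IdemMat A) :
    traceK0 τ hτ (K0.cls e) = traceExt τ e.mat := by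
  have h := Equiv.symm_apply_apply (Algebra.GrothendieckAddGroup.lift (M := StableClass A) (G := E))
  unfold traceK0 K0.cls
  exact DFunLike.congr_fun (h _) _

end Trace

section GeneralLinear

theorem matPad_add {R : Type*} [Ring R] {n : ℕ} (m : ℕ) (x y : Matrix (Fin n) (Fin n) R) :
    matPad m (x + y) = matPad m x + matPad m y := by
  simp only [matPad_eq, Matrix.mul_add, Matrix.add_mul]

theorem matPad_sub {R : Type*} [Ring R] {n : ℕ} (m : ℕ) (x y : Matrix (Fin n) (Fin n) R) :
    matPad m (x - y) = matPad m x - matPad m y := by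
  simp only [matPad_eq, Matrix.mul_sub, Matrix.sub_mul]

/-- The inclusion `x ↦ diag(x, 1)` on the level of matrices: `diag(x, 0) + (1 - diag(1, 0))`. -/
def matPadOne {R : Type*} [Ring R] {n : ℕ} (m : ℕ) (x : Matrix (Fin n) (Fin n) R) :
    Matrix (Fin m) (Fin m) R :=
  matPad m x + (1 - matPad m (1 : Matrix (Fin n) (Fin n) R))

theorem matPadOne_mul {R : Type*} [Ring R] {n m : ℕ} (h : n ≤ m)
    (x y : Matrix (Fin n) (Fin n) R) :
    matPadOne m (x * y) = matPadOne m x * matPadOne m y := by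
  simp only [matPadOne, add_mul, mul_add, sub_mul, mul_sub, ← matPad_mul h, mul_one, one_mul]
  abel

theorem matPadOne_one {R : Type*} [Ring R] (n m : ℕ) :
    matPadOne m (1 : Matrix (Fin n) (Fin n) R) = 1 := by
  simp [matPadOne]

/-- The inclusion `GL_n(R) → GL_m(R)`, `x ↦ diag(x, 1)`, for `n ≤ m`. -/
def glPad {R : Type*} [Ring R] {n m : ℕ} (h : n ≤ m) :
    (Matrix (Fin n) (Fin n) R)ˣ →* (Matrix (Fin m) (Fin m) R)ˣ :=
  Units.map
    { toFun := matPadOne m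
      map_one' := matPadOne_one n m
      map_mul' := matPadOne_mul h }

theorem glPad_val {R : Type*} [Ring R] {n m : ℕ} (h : n ≤ m) (u : (Matrix (Fin n) (Fin n) R)ˣ) :
    (glPad h u).1 = matPadOne m u.1 := rfl

instance glDirected (R : Type*) [Ring R] :
    DirectedSystem (fun n : ℕ => (Matrix (Fin n) (Fin n) R)ˣ)
      (fun _ _ h => ⇑(glPad (R := R) h)) where
  map_self n x := by
    ext1
    simp [glPad_val, matPadOne, matPad_self]
  map_map n m k h h' x := by
    ext1
    simp [glPad_val, matPadOne, matPad_add, matPad_sub, matPad_matPad h]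
    abel

/-- The group `GL_∞(R)`, the union of the groups `GL_n(R)`. -/
def GLInf (R : Type*) [Ring R] : Type _ :=
  DirectLimit (fun n : ℕ => (Matrix (Fin n) (Fin n) R)ˣ) (fun _ _ h => glPad (R := R) h)

noncomputable instance GLInf.instGroup (R : Type*) [Ring R] : Group (GLInf R) :=
  inferInstanceAs (Group (DirectLimit (fun n : ℕ => (Matrix (Fin n) (Fin n) R)ˣ)
    (fun _ _ h => glPad (R := R) h)))

/-- The inclusion of `GL_n(R)` in `GL_∞(R)`. -/
noncomputable def toGLInf {R : Type*} [Ring R] (n : ℕ) : (Matrix (Fin n) (Fin n) R)ˣ →* GLInf R where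
  toFun u := (⟦⟨n, u⟩⟧ : DirectLimit (fun n : ℕ => (Matrix (Fin n) (Fin n) R)ˣ)
    (fun _ _ h => glPad (R := R) h))
  map_one' := (DirectLimit.one_def (f := fun _ _ h => glPad (R := R) h) n).symm
  map_mul' x y := (DirectLimit.mul_def (f := fun _ _ h => glPad (R := R) h) n x y).symm

theorem toGLInf_glPad {R : Type*} [Ring R] {n m : ℕ} (h : n ≤ m)
    (u : (Matrix (Fin n) (Fin n) R)ˣ) : toGLInf m (glPad h u) = toGLInf n u :=
  (DirectLimit.mk_apply (F := fun n : ℕ => (Matrix (Fin n) (Fin n) R)ˣ)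
    (f := fun _ _ h => glPad (R := R) h) n m u h)

theorem exists_toGLInf {R : Type*} [Ring R] (x : GLInf R) :
    ∃ (n : ℕ) (u : (Matrix (Fin n) (Fin n) R)ˣ), toGLInf n u = x := by
  obtain ⟨n, u, h⟩ := DirectLimit.exists_eq_mk (f := fun _ _ h => glPad (R := R) h) x
  exact ⟨n, u, h.symm⟩

/-- The inductive limit topology on `GL_∞(A)`: a set is open if and only if its trace on each
`GL_n(A)` is open. Here `GL_n(A)` is the unit group of `M_n(A)`, with its usual topology. -/
noncomputable instance GLInf.instTopologicalSpace (A : Type*) [NormedRing A] : TopologicalSpace (GLInf A) :=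
  ⨆ n : ℕ, TopologicalSpace.coinduced (toGLInf (R := A) n) inferInstance

theorem continuous_toGLInf {A : Type*} [NormedRing A] (n : ℕ) :
    Continuous (toGLInf (R := A) n) :=
  continuous_iff_coinduced_le.2
    (le_iSup (fun n : ℕ => TopologicalSpace.coinduced (toGLInf (R := A) n) inferInstance) n)

theorem continuous_glInf_iff {A X : Type*} [NormedRing A] [TopologicalSpace X] {f : GLInf A → X} :
    Continuous f ↔ ∀ n, Continuous fun u => f (toGLInf n u) := by
  rw [continuous_iSup_dom]
  exact forall_congr' fun n => continuous_coinduced_dom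

theorem continuous_matPadOne {A : Type*} [NormedRing A] {n : ℕ} (m : ℕ) :
    Continuous (matPadOne m : Matrix (Fin n) (Fin n) A → Matrix (Fin m) (Fin m) A) := by
  unfold matPadOne
  simp only [matPad_eq]
  fun_prop

theorem continuous_glPad {A : Type*} [NormedRing A] {n m : ℕ} (h : n ≤ m) :
    Continuous (glPad (R := A) h) :=
  Continuous.units_map _ (continuous_matPadOne m)

theorem glInf_continuous_const_mul {A : Type*} [NormedRing A] (x : GLInf A) :
    Continuous (x * ·) := by
  rw [continuous_glInf_iff]
  intro n
  obtain ⟨m, v, rfl⟩ := exists_toGLInf x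
  have : (fun u => toGLInf m v * toGLInf n u) = fun u : (Matrix (Fin n) (Fin n) A)ˣ =>
      toGLInf (max m n) (glPad (le_max_left m n) v * glPad (le_max_right m n) u) := by
    funext u
    rw [map_mul, toGLInf_glPad, toGLInf_glPad]
  rw [this]
  exact (continuous_toGLInf _).comp (continuous_const.mul (continuous_glPad _))

/-- The connected component `GL_∞⁰(A)` of the identity in `GL_∞(A)`. -/
noncomputable def GLInfZero (A : Type*) [NormedRing A] : Subgroup (GLInf A) where
  carrier := connectedComponent 1
  one_mem' := mem_connectedComponent
  mul_mem' := by
    intro x y hx hy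
    have h := (glInf_continuous_const_mul x).image_connectedComponent_subset 1 ⟨y, hy, rfl⟩
    rw [mul_one] at h
    rwa [connectedComponent_eq hx]
  inv_mem' := by
    intro x hx
    have h := (glInf_continuous_const_mul x⁻¹).image_connectedComponent_subset x
      ⟨1, connectedComponent_eq hx ▸ mem_connectedComponent, rfl⟩
    simpa using h

end GeneralLinear

section Determinant
open MeasureTheory

/-- A piecewise differentiable function on `[a, b]`: continuous on `[a, b]`, differentiable at all
but finitely many points, with integrable derivative. -/
def IsPiecewiseDifferentiable {V : Type*} [NormedAddCommGroup V] [NormedSpace ℝ V] (f : ℝ → V)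
    (a b : ℝ) : Prop :=
  ContinuousOn f (Set.Icc a b) ∧
  (∃ S : Set ℝ, S.Finite ∧ ∀ t ∈ Set.Ioo a b \ S, DifferentiableAt ℝ f t) ∧
  IntervalIntegrable (deriv f) volume a b

/-- A piecewise differentiable path `[left, right] → GL_∞⁰(A)`. Since `[left, right]` is compact,
such a path takes its values in some `GL_n(A)`, and it is piecewise differentiable as a path in
the Banach space `M_n(A)`, that is, entry by entry. The values of `toFun` outside
`[left, right]` are irrelevant. -/
structure PiecewisePath (A : Type*) [NormedRing A] [NormedAlgebra ℂ A] where
  left : ℝ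
  right : ℝ
  le : left ≤ right
  level : ℕ
  toFun : ℝ → (Matrix (Fin level) (Fin level) A)ˣ
  mem : ∀ t ∈ Set.Icc left right, toGLInf level (toFun t) ∈ GLInfZero A
  piecewise : ∀ i j, IsPiecewiseDifferentiable (fun t => (toFun t).1 i j) left right

/-- The origin of a path. -/
noncomputable def PiecewisePath.source {A : Type*} [NormedRing A] [NormedAlgebra ℂ A] (ξ : PiecewisePath A) :
    GLInfZero A :=
  ⟨toGLInf ξ.level (ξ.toFun ξ.left), ξ.mem _ (Set.left_mem_Icc.2 ξ.le)⟩

/-- The extremity of a path. -/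
noncomputable def PiecewisePath.target {A : Type*} [NormedRing A] [NormedAlgebra ℂ A] (ξ : PiecewisePath A) :
    GLInfZero A :=
  ⟨toGLInf ξ.level (ξ.toFun ξ.right), ξ.mem _ (Set.right_mem_Icc.2 ξ.le)⟩

/-- The velocity of a path in `M_n(A)`. -/
noncomputable def PiecewisePath.velocity {A : Type*} [NormedRing A] [NormedAlgebra ℂ A]
    (ξ : PiecewisePath A) (t : ℝ) : Matrix (Fin ξ.level) (Fin ξ.level) A :=
  Matrix.of fun i j => deriv (fun s => (ξ.toFun s).1 i j) t

/-- `(2πi)⁻¹ ∫ τ(ξ'(t) ξ(t)⁻¹) dt`. -/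
noncomputable def deltaTilde {A E : Type*} [NormedRing A] [NormedAlgebra ℂ A]
    [NormedAddCommGroup E] [NormedSpace ℂ E] (τ : A →L[ℂ] E) (ξ : PiecewisePath A) : E :=
  (2 * Real.pi * Complex.I : ℂ)⁻¹ •
    ∫ t in ξ.left..ξ.right, traceExt τ (ξ.velocity t * ((ξ.toFun t)⁻¹).1)

open Classical in
/-- The map `Δ_τ : GL_∞⁰(A) → E / τ(K₀(A))`, sending `x` to the class of `deltaTilde τ ξ` for a
chosen piecewise differentiable path `ξ` from `1` to `x` (and to `0` if there were none). -/
noncomputable def deltaMap {A E : Type*} [NormedRing A] [NormedAlgebra ℂ A]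
    [NormedAddCommGroup E] [NormedSpace ℂ E] (τ : A →L[ℂ] E) (hτ : ∀ x y, τ (y * x) = τ (x * y))
    (x : GLInfZero A) : E ⧸ (traceK0 τ hτ).range :=
  if h : ∃ ξ : PiecewisePath A, ξ.source = 1 ∧ ξ.target = x then
    QuotientAddGroup.mk (deltaTilde τ h.choose)
  else 0

theorem matExp_mul_neg {A : Type*} [NormedRing A] [NormedAlgebra ℂ A] [CompleteSpace A] {n : ℕ}
    (y : Matrix (Fin n) (Fin n) A) : NormedSpace.exp y * NormedSpace.exp (-y) = 1 := by
  let _ : NormedAlgebra ℚ A := NormedAlgebra.restrictScalars ℚ ℂ A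
  rw [← Matrix.exp_add_of_commute y (-y) (Commute.refl y).neg_right]
  simp

/-- The exponential `e^y ∈ GL_n(A)` of a matrix `y ∈ M_n(A)`. -/
noncomputable def glExp {A : Type*} [NormedRing A] [NormedAlgebra ℂ A] [CompleteSpace A] {n : ℕ}
    (y : Matrix (Fin n) (Fin n) A) : (Matrix (Fin n) (Fin n) A)ˣ where
  val := NormedSpace.exp y
  inv := NormedSpace.exp (-y)
  val_inv := matExp_mul_neg y
  inv_val := by simpa using matExp_mul_neg (-y)

end Determinant

/-! Traciality makes the integral of `τ(ξ' ξ⁻¹)` additive under pointwise multiplication of paths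
(`logDerivIntegral_mul`). Two paths from `1` to `x` therefore differ by a loop, and everything rests
on showing that a loop in `GL_n(A)` has its integral, divided by `2πi`, in the image of `K₀(A)`
(`logDerivIntegral_mem_range_traceK0`).

A loop `f` is uniformly close to a trigonometric polynomial `p`. The loop `f⁻¹ p` stays in the unit
ball around `1`, where the power series of the logarithm, composed with the trace, is a primitive,
so its integral vanishes and `f` may be replaced by `p`. Write `p = z^(-N) q` with `q` a polynomial
in `z = e^(2πit)`; the scalar factor contributes `-N τ(1)`. Doubling the matrix size lowers the
degree of `q` without changing the trace of its logarithmic derivative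
(`exists_unit_linearization`), which leads to a pencil `b + z a`. There `(2πi)⁻¹ ∮ a (b + z a)⁻¹ dz`
is a Riesz idempotent (`exists_idempotent_of_linear_pencil`), whose trace is the value of `τ` on a
class of `K₀(A)`.

Paths from `1` exist because the elements they reach form a clopen set. The path `e^(ty)` has
constant logarithmic derivative `y`, which gives (ii) and one inclusion for the image; the other
holds since `τ` commutes with the integral. -/

open MeasureTheory Set

set_option linter.unusedSectionVars false

/-! ### Calculus of piecewise differentiable functions. -/

section PiecewiseCalculus

variable {V : Type*} [NormedAddCommGroup V] [NormedSpace ℝ V]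

theorem ae_uIoc_imp_mem_Ioo_diff {a b : ℝ} (hab : a ≤ b) {S : Set ℝ} (hS : S.Finite) :
    ∀ᵐ t : ℝ, t ∈ uIoc a b → t ∈ Ioo a b \ S := by
  -- The half-open interval contains `b`, which is discarded together with `S`.
  have h : ∀ᵐ t : ℝ, t ∉ insert b S :=
    measure_eq_zero_iff_ae_notMem.1 ((hS.insert b).measure_zero _)
  filter_upwards [h] with t ht htab
  rw [uIoc_of_le hab] at htab
  simp only [mem_insert_iff, not_or] at ht
  exact ⟨⟨htab.1, lt_of_le_of_ne htab.2 ht.1⟩, ht.2⟩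

theorem IntervalIntegrable.congr_of_forall_Ioo_diff {f g : ℝ → V} {a b : ℝ} (hab : a ≤ b)
    {S : Set ℝ} (hS : S.Finite) (h : ∀ t ∈ Ioo a b \ S, f t = g t)
    (hf : IntervalIntegrable f volume a b) : IntervalIntegrable g volume a b := by
  refine hf.congr_ae ?_
  rw [Filter.EventuallyEq, ae_restrict_iff' measurableSet_uIoc]
  filter_upwards [ae_uIoc_imp_mem_Ioo_diff hab hS] with t ht htab using h t (ht htab)

theorem intervalIntegral_congr_of_forall_Ioo_diff {f g : ℝ → V} {a b : ℝ} (hab : a ≤ b)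
    {S : Set ℝ} (hS : S.Finite) (h : ∀ t ∈ Ioo a b \ S, f t = g t) :
    ∫ t in a..b, f t = ∫ t in a..b, g t := by
  refine intervalIntegral.integral_congr_ae ?_
  filter_upwards [ae_uIoc_imp_mem_Ioo_diff hab hS] with t ht htab using h t (ht htab)

/-- The default values of `deriv` at the exceptional points form a null set of changes, so
integrability may be tested on any `f'` that is the derivative elsewhere. -/
theorem IsPiecewiseDifferentiable.of_hasDerivAt {f f' : ℝ → V} {a b : ℝ} (hab : a ≤ b)
    (hc : ContinuousOn f (Icc a b)) {S : Set ℝ} (hS : S.Finite)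
    (hd : ∀ t ∈ Ioo a b \ S, HasDerivAt f (f' t) t) (hi : IntervalIntegrable f' volume a b) :
    IsPiecewiseDifferentiable f a b :=
  ⟨hc, ⟨S, hS, fun t ht => (hd t ht).differentiableAt⟩,
    hi.congr_of_forall_Ioo_diff hab hS fun t ht => (hd t ht).deriv.symm⟩

theorem IsPiecewiseDifferentiable.of_hasDerivAt_continuous {f f' : ℝ → V} {a b : ℝ} (hab : a ≤ b)
    (hd : ∀ t, HasDerivAt f (f' t) t) (hc : Continuous f') :
    IsPiecewiseDifferentiable f a b :=
  .of_hasDerivAt hab (fun t _ => (hd t).continuousAt.continuousWithinAt) finite_empty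
    (fun t _ => hd t) (hc.intervalIntegrable a b)

theorem IsPiecewiseDifferentiable.clm_comp {W : Type*} [NormedAddCommGroup W] [NormedSpace ℝ W]
    {f : ℝ → V} {a b : ℝ} (hab : a ≤ b) (hf : IsPiecewiseDifferentiable f a b) (L : V →L[ℝ] W) :
    IsPiecewiseDifferentiable (fun t => L (f t)) a b := by
  obtain ⟨hc, ⟨S, hS, hd⟩, hi⟩ := hf
  exact .of_hasDerivAt hab (L.continuous.comp_continuousOn hc) hS
    (fun t ht => L.hasFDerivAt.comp_hasDerivAt t (hd t ht).hasDerivAt)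
    ⟨L.integrable_comp hi.1, L.integrable_comp hi.2⟩

theorem IsPiecewiseDifferentiable.finset_sum {ι : Type*} {f : ι → ℝ → V} {a b : ℝ} (hab : a ≤ b)
    (s : Finset ι) (hf : ∀ i ∈ s, IsPiecewiseDifferentiable (f i) a b) :
    IsPiecewiseDifferentiable (fun t => ∑ i ∈ s, f i t) a b := by
  classical
  choose! S hS hd using fun i hi => (hf i hi).2.1
  refine .of_hasDerivAt (f' := fun t => ∑ i ∈ s, deriv (f i) t) hab
    (continuousOn_finsetSum s fun i hi => (hf i hi).1)
    (S := ⋃ i ∈ s, S i) (s.finite_toSet.biUnion hS) (fun t ht => ?_) ?_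
  · exact HasDerivAt.fun_sum fun i hi => (hd i hi t
      ⟨ht.1, fun h => ht.2 (mem_biUnion (Finset.mem_coe.2 hi) h)⟩).hasDerivAt
  · simpa only [Finset.sum_fn] using IntervalIntegrable.sum s fun i hi => (hf i hi).2.2

theorem IsPiecewiseDifferentiable.comp_affine {f : ℝ → V} {a b : ℝ} (hab : a ≤ b)
    (hf : IsPiecewiseDifferentiable f a b) :
    IsPiecewiseDifferentiable (fun t => f ((b - a) * t + a)) 0 1 := by
  -- When `a = b` the reparametrization is constant and not injective, so the preimage of the
  -- exceptional set could be infinite; the path itself is then constant.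
  rcases hab.eq_or_lt with rfl | hlt
  · exact .of_hasDerivAt_continuous (f' := fun _ => 0) zero_le_one
      (fun t => by simpa using hasDerivAt_const t (f a)) continuous_const
  obtain ⟨hc, ⟨S, hS, hd⟩, hi⟩ := hf
  have hba : 0 < b - a := sub_pos.2 hlt
  have hinj : Function.Injective fun t : ℝ => (b - a) * t + a := fun x y hxy => by
    simpa [hba.ne'] using hxy
  refine .of_hasDerivAt (f' := fun t => (b - a) • deriv f ((b - a) * t + a)) zero_le_one ?_
    (hS.preimage hinj.injOn) (fun t ht => ?_) ?_
  · refine hc.comp (by fun_prop) fun t ht => ?_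
    constructor <;> nlinarith [ht.1, ht.2]
  · have hmem : (b - a) * t + a ∈ Ioo a b \ S := by
      refine ⟨?_, ht.2⟩
      constructor <;> nlinarith [ht.1.1, ht.1.2]
    have h1 : HasDerivAt (fun t : ℝ => (b - a) * t + a) (b - a) t := by
      simpa using ((hasDerivAt_id t).const_mul (b - a)).add_const a
    exact (hd _ hmem).hasDerivAt.scomp t h1
  · refine IntervalIntegrable.smul ?_ _
    have h2 := (hi.comp_add_right a).comp_mul_left (c := b - a)
    have h3 : (a - a) / (b - a) = 0 := by simp
    have h4 : (b - a) / (b - a) = 1 := div_self hba.ne'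
    rwa [h3, h4] at h2

end PiecewiseCalculus

/-! ### Integrals of logarithmic derivatives in a Banach algebra. -/

section LogDerivIntegral

variable {B E : Type*} [NormedRing B] [NormedAlgebra ℂ B] [CompleteSpace B]
  [NormedAddCommGroup E] [NormedSpace ℂ E]

/-- The integral `∫ T(f' f⁻¹)` of the logarithmic derivative of a path of units. -/
noncomputable def logDerivIntegral (T : B →L[ℂ] E) (f : ℝ → Bˣ) (a b : ℝ) : E :=
  ∫ t in a..b, T (deriv (fun s => (f s).1) t * ((f t)⁻¹).1)

/-- By completeness the unit group carries the subspace topology, so norm continuity of a path of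
units already gives continuity of its inverse. -/
theorem continuousOn_units_iff {X : Type*} [TopologicalSpace X] {f : X → Bˣ} {s : Set X} :
    ContinuousOn f s ↔ ContinuousOn (fun t => (f t).1) s :=
  Units.isOpenEmbedding_val.isInducing.continuousOn_iff

theorem continuousOn_inv_units {f : ℝ → Bˣ} {s : Set ℝ} (hf : ContinuousOn (fun t => (f t).1) s) :
    ContinuousOn (fun t => ((f t)⁻¹).1) s :=
  Units.continuous_val.comp_continuousOn (continuousOn_units_iff.2 hf).inv

theorem hasDerivAt_units_inv {f : ℝ → Bˣ} {f' : B} {t : ℝ}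
    (hf : HasDerivAt (fun t => (f t).1) f' t) :
    HasDerivAt (fun t => ((f t)⁻¹).1) (-(((f t)⁻¹).1 * f' * ((f t)⁻¹).1)) t := by
  have h := (hasFDerivAt_ringInverse (𝕜 := ℝ) (f t)).comp_hasDerivAt t hf
  simpa [Function.comp_def, mul_assoc] using h

theorem IsPiecewiseDifferentiable.units_inv {f : ℝ → Bˣ} {a b : ℝ} (hab : a ≤ b)
    (hf : IsPiecewiseDifferentiable (fun t => (f t).1) a b) :
    IsPiecewiseDifferentiable (fun t => ((f t)⁻¹).1) a b := by
  obtain ⟨hc, ⟨S, hS, hd⟩, hi⟩ := hf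
  have hc' : ContinuousOn (fun t => ((f t)⁻¹).1) (uIcc a b) := by
    rw [uIcc_of_le hab]
    exact continuousOn_inv_units hc
  exact .of_hasDerivAt hab (continuousOn_inv_units hc) hS
    (fun t ht => hasDerivAt_units_inv (hd t ht).hasDerivAt)
    ((hi.continuousOn_mul hc').mul_continuousOn hc').neg

theorem IsPiecewiseDifferentiable.mul {f g : ℝ → B} {a b : ℝ} (hab : a ≤ b)
    (hf : IsPiecewiseDifferentiable f a b) (hg : IsPiecewiseDifferentiable g a b) :
    IsPiecewiseDifferentiable (fun t => f t * g t) a b := by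
  obtain ⟨hc, ⟨S, hS, hd⟩, hi⟩ := hf
  obtain ⟨hc', ⟨S', hS', hd'⟩, hi'⟩ := hg
  refine .of_hasDerivAt (f' := fun t => deriv f t * g t + f t * deriv g t) hab (hc.mul hc')
    (hS.union hS') (fun t ht => ?_) ?_
  · exact (hd t ⟨ht.1, fun h => ht.2 (Or.inl h)⟩).hasDerivAt.mul
      (hd' t ⟨ht.1, fun h => ht.2 (Or.inr h)⟩).hasDerivAt
  · rw [← uIcc_of_le hab] at hc hc'
    exact (hi.mul_continuousOn hc').add (hi'.continuousOn_mul hc)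

theorem intervalIntegrable_logDeriv {f : ℝ → Bˣ} {a b : ℝ} (hab : a ≤ b)
    (hf : IsPiecewiseDifferentiable (fun t => (f t).1) a b) :
    IntervalIntegrable (fun t => deriv (fun s => (f s).1) t * ((f t)⁻¹).1) volume a b := by
  refine hf.2.2.mul_continuousOn ?_
  rw [uIcc_of_le hab]
  exact continuousOn_inv_units hf.1

theorem intervalIntegrable_clm_logDeriv (T : B →L[ℂ] E) {f : ℝ → Bˣ} {a b : ℝ} (hab : a ≤ b)
    (hf : IsPiecewiseDifferentiable (fun t => (f t).1) a b) :
    IntervalIntegrable (fun t => T (deriv (fun s => (f s).1) t * ((f t)⁻¹).1)) volume a b :=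
  have h := intervalIntegrable_logDeriv hab hf
  ⟨T.integrable_comp h.1, T.integrable_comp h.2⟩

theorem logDerivIntegral_eq_apply [CompleteSpace E] (T : B →L[ℂ] E) {f : ℝ → Bˣ} {a b : ℝ}
    (hab : a ≤ b) (hf : IsPiecewiseDifferentiable (fun t => (f t).1) a b) :
    logDerivIntegral T f a b = T (∫ t in a..b, deriv (fun s => (f s).1) t * ((f t)⁻¹).1) :=
  T.intervalIntegral_comp_comm (intervalIntegrable_logDeriv hab hf)

/-- `(fg)'(fg)⁻¹ = f'f⁻¹ + f (g'g⁻¹) f⁻¹`, and a tracial map does not see the conjugation by `f`. -/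
theorem logDerivIntegral_mul (T : B →L[ℂ] E) (hT : ∀ x y, T (x * y) = T (y * x))
    {f g : ℝ → Bˣ} {a b : ℝ} (hab : a ≤ b)
    (hf : IsPiecewiseDifferentiable (fun t => (f t).1) a b)
    (hg : IsPiecewiseDifferentiable (fun t => (g t).1) a b) :
    logDerivIntegral T (fun t => f t * g t) a b =
      logDerivIntegral T f a b + logDerivIntegral T g a b := by
  unfold logDerivIntegral
  rw [← intervalIntegral.integral_add (intervalIntegrable_clm_logDeriv T hab hf)
    (intervalIntegrable_clm_logDeriv T hab hg)]
  obtain ⟨S, hS, hd⟩ := hf.2.1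
  obtain ⟨S', hS', hd'⟩ := hg.2.1
  refine intervalIntegral_congr_of_forall_Ioo_diff hab (hS.union hS') fun t ht => ?_
  have h1 := (hd t ⟨ht.1, fun h => ht.2 (Or.inl h)⟩).hasDerivAt
  have h2 := (hd' t ⟨ht.1, fun h => ht.2 (Or.inr h)⟩).hasDerivAt
  have h3 := (h1.mul h2).deriv
  simp only [Units.val_mul, mul_inv_rev]
  erw [h3]
  rw [add_mul, map_add]
  congr 1
  · congr 1
    rw [mul_assoc, ← mul_assoc (g t).1, Units.mul_inv, one_mul]
  · rw [hT, mul_assoc, ← mul_assoc ((f t)⁻¹).1, Units.inv_mul, one_mul, hT]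

theorem logDerivIntegral_const (T : B →L[ℂ] E) (u : Bˣ) (a b : ℝ) :
    logDerivIntegral T (fun _ => u) a b = 0 := by
  simp [logDerivIntegral]

theorem logDerivIntegral_inv (T : B →L[ℂ] E) (hT : ∀ x y, T (x * y) = T (y * x))
    {f : ℝ → Bˣ} {a b : ℝ} (hab : a ≤ b)
    (hf : IsPiecewiseDifferentiable (fun t => (f t).1) a b) :
    logDerivIntegral T (fun t => (f t)⁻¹) a b = - logDerivIntegral T f a b := by
  have h := logDerivIntegral_mul T hT hab hf (hf.units_inv hab)
  simp only [mul_inv_cancel, logDerivIntegral_const] at h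
  exact eq_neg_of_add_eq_zero_right h.symm

/-- The chain rule factor is the Jacobian of the substitution. No regularity of `f` is needed: the
scaling rules for `deriv` and for the integral persist for their default values, and for `a = b`. -/
theorem logDerivIntegral_comp_affine (T : B →L[ℂ] E) (f : ℝ → Bˣ) (a b : ℝ) :
    logDerivIntegral T (fun t => f ((b - a) * t + a)) 0 1 = logDerivIntegral T f a b := by
  unfold logDerivIntegral
  have h : ∀ t : ℝ, deriv (fun s => (f ((b - a) * s + a)).1) t =
      (b - a) • deriv (fun s => (f s).1) ((b - a) * t + a) := fun t => by
    have h1 := deriv_comp_mul_left (b - a) (fun s => (f (s + a)).1) t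
    rw [h1, deriv_comp_add_const (f := fun s => (f s).1)]
  have h2 := intervalIntegral.smul_integral_comp_mul_add (a := 0) (b := 1)
    (fun t => T (deriv (fun s => (f s).1) t * ((f t)⁻¹).1)) (b - a) a
  simp only [mul_zero, zero_add, mul_one, sub_add_cancel] at h2
  rw [← h2, ← intervalIntegral.integral_smul]
  refine intervalIntegral.integral_congr fun t _ => ?_
  simp only [h, smul_mul_assoc]
  exact T.map_smul_of_tower (b - a) _

theorem logDerivIntegral_of_hasDerivAt_mul [CompleteSpace E] (T : B →L[ℂ] E)
    (hT : ∀ x y, T (x * y) = T (y * x)) {f : ℝ → Bˣ} {y : B}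
    (hf : ∀ t, HasDerivAt (fun t => (f t).1) ((f t).1 * y) t) :
    logDerivIntegral T f 0 1 = T y := by
  have h : ∀ t : ℝ, T (deriv (fun s => (f s).1) t * ((f t)⁻¹).1) = T y := fun t => by
    rw [(hf t).deriv, hT, Units.inv_mul_cancel_left]
  simp [logDerivIntegral, h]

end LogDerivIntegral

/-! ### The logarithm under a trace, and loops near `1`. -/

section TracialLogarithm

variable {B E : Type*} [NormedRing B] [NormedAlgebra ℂ B] [CompleteSpace B]
  [NormedAddCommGroup E] [NormedSpace ℂ E]

/-- The series `∑ T(x ^ (k + 1)) / (k + 1)`, that is, `-T(log(1 - x))`. -/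
noncomputable def tracialLog (T : B →L[ℂ] E) (x : B) : E :=
  ∑' k : ℕ, ((k : ℂ) + 1)⁻¹ • T (x ^ (k + 1))

/-- The derivative of `x ^ (k + 1)` in direction `y` is the sum of the `x ^ (k - i) y x ^ i`. Under
a trace these `k + 1` terms coincide and the factor `(k + 1)⁻¹` cancels, as in the commutative case.
-/
theorem hasFDerivAt_tracial_pow (T : B →L[ℂ] E) (hT : ∀ x y, T (x * y) = T (y * x)) (k : ℕ)
    (x : B) : HasFDerivAt (fun x => ((k : ℂ) + 1)⁻¹ • T (x ^ (k + 1)))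
      (T ∘L (ContinuousLinearMap.mul ℂ B).flip (x ^ k)) x := by
  have h := (T.hasFDerivAt.comp x
    (hasStrictFDerivAt_pow' (𝕜 := ℂ) (k + 1) (x := x)).hasFDerivAt).const_smul ((k : ℂ) + 1)⁻¹
  refine h.congr_fderiv ?_
  ext y
  have h1 : ∀ i ∈ Finset.range (k + 1), T (x ^ (k - i) * (y * x ^ i)) = T (y * x ^ k) := by
    intro i hi
    rw [hT, mul_assoc, ← pow_add, Nat.add_sub_cancel' (Finset.mem_range_succ_iff.1 hi)]
  simp only [smul_apply, ContinuousLinearMap.comp_apply,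
    sum_apply, map_sum, ContinuousLinearMap.flip_apply,
    ContinuousLinearMap.mul_apply', ContinuousLinearMap.id_apply, Nat.pred_succ, smul_eq_mul,
    op_smul_eq_mul, mul_assoc]
  rw [Finset.sum_congr rfl h1, Finset.sum_const, Finset.card_range, ← Nat.cast_smul_eq_nsmul ℂ,
    smul_smul, Nat.cast_add_one, inv_mul_cancel₀ (Nat.cast_add_one_ne_zero k), one_smul]

/-- The norm of `1` is not assumed to be `1`, hence the constant, which covers `k = 0`. -/
theorem norm_pow_le_add_one_mul (x : B) (k : ℕ) : ‖x ^ k‖ ≤ (‖(1 : B)‖ + 1) * ‖x‖ ^ k := by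
  rcases k.eq_zero_or_pos with rfl | hk
  · simp
  · exact (norm_pow_le' x hk).trans (le_mul_of_one_le_left (by positivity) (by simp))

/-- Termwise differentiation: on a ball of radius `r` with `‖x‖ < r < 1` the derivatives are
dominated by a geometric series. Their sum is `y ↦ T(y (1 - x)⁻¹)`. -/
theorem hasFDerivAt_tracialLog [CompleteSpace E] (T : B →L[ℂ] E)
    (hT : ∀ x y, T (x * y) = T (y * x)) {x : B} (hx : ‖x‖ < 1) :
    HasFDerivAt (tracialLog T) (T ∘L (ContinuousLinearMap.mul ℂ B).flip (∑' k, x ^ k)) x := by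
  obtain ⟨r, hxr, hr⟩ := exists_between hx
  have hr0 : 0 ≤ r := (norm_nonneg x).trans hxr.le
  have h0r : (0 : B) ∈ Metric.ball (0 : B) r := by simpa using (norm_nonneg x).trans_lt hxr
  have hs : Summable fun k : ℕ => ‖T‖ * ((‖(1 : B)‖ + 1) * r ^ k) :=
    ((summable_geometric_of_lt_one hr0 hr).mul_left _).mul_left _
  have h := hasFDerivAt_tsum_of_isPreconnected (𝕜 := ℂ) (s := Metric.ball (0 : B) r) hs
    Metric.isOpen_ball (convex_ball (0 : B) r).isPreconnected
    (fun k y _ => hasFDerivAt_tracial_pow T hT k y) (fun k y hy => ?_) h0r ?_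
    (x := x) (by simpa using hxr)
  · refine h.congr_fderiv ?_
    have h1 := (summable_geometric_of_norm_lt_one hx).hasSum
    exact ((((ContinuousLinearMap.mul ℂ B).flip.hasSum h1).mapL
      (ContinuousLinearMap.compL ℂ B B E T))).tsum_eq
  · refine (T.opNorm_comp_le _).trans (mul_le_mul_of_nonneg_left ?_ (norm_nonneg T))
    refine ContinuousLinearMap.opNorm_le_bound _ (by positivity) fun z => ?_
    simp only [ContinuousLinearMap.flip_apply, ContinuousLinearMap.mul_apply']
    refine (norm_mul_le _ _).trans ?_
    rw [mul_comm]
    refine mul_le_mul_of_nonneg_right ((norm_pow_le_add_one_mul y k).trans ?_) (norm_nonneg z)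
    have hy' : ‖y‖ ≤ r := by simpa using (Metric.mem_ball.1 hy).le
    gcongr
  · simp only [pow_succ, mul_zero, map_zero, smul_zero]
    exact summable_zero

/-- A closed path of units near `1` has trivial logarithmic derivative integral. -/
theorem logDerivIntegral_eq_zero_of_norm_lt_one [CompleteSpace E] (T : B →L[ℂ] E)
    (hT : ∀ x y, T (x * y) = T (y * x)) {f : ℝ → Bˣ} {a b : ℝ} (hab : a ≤ b)
    (hf : IsPiecewiseDifferentiable (fun t => (f t).1) a b) (hfab : f a = f b)
    (hlt : ∀ t ∈ Icc a b, ‖1 - (f t).1‖ < 1) : logDerivIntegral T f a b = 0 := by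
  obtain ⟨S, hS, hd⟩ := hf.2.1
  have hinv : ∀ t ∈ Icc a b, ∑' k, (1 - (f t).1) ^ k = ((f t)⁻¹).1 := fun t ht => by
    have h := mul_neg_geom_series _ (hlt t ht)
    rw [sub_sub_cancel] at h
    exact (Units.inv_eq_of_mul_eq_one_right h).symm
  -- `-tracialLog T (1 - f)` plays the role of `T(log f)`: it is a primitive of the integrand off
  -- `S`, with equal values at `a` and `b`.
  have h := integral_eq_of_hasDerivAt_off_countable (fun t => - tracialLog T (1 - (f t).1))
    (fun t => T (deriv (fun s => (f s).1) t * ((f t)⁻¹).1)) hS.countable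
    (a := a) (b := b) ?_ ?_ (intervalIntegrable_clm_logDeriv T hab hf)
  · rw [logDerivIntegral, h, hfab, sub_self]
  · rw [uIcc_of_le hab]
    intro t ht
    have h1 : ContinuousWithinAt (fun t => 1 - (f t).1) (Icc a b) t :=
      continuousWithinAt_const.sub (hf.1 t ht)
    exact ((hasFDerivAt_tracialLog T hT (hlt t ht)).continuousAt.comp_continuousWithinAt
      (f := fun t => 1 - (f t).1) h1).neg
  · rw [min_eq_left hab, max_eq_right hab]
    intro t ht
    have htI := Ioo_subset_Icc_self ht.1
    have h1 := (hd t ht).hasDerivAt.const_sub 1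
    have h2 := (((hasFDerivAt_tracialLog T hT (hlt t htI)).restrictScalars ℝ).comp_hasDerivAt t
      h1).neg
    refine h2.congr_deriv ?_
    simp [hinv t htI]

end TracialLogarithm

/-! ### The Riesz idempotent of a linear pencil on the unit circle. -/

section RieszProjection

open Filter Topology

variable {B E : Type*} [NormedRing B] [NormedAlgebra ℂ B] [CompleteSpace B]
  [NormedAddCommGroup E] [NormedSpace ℂ E]

/-- If `G` is formally the sequence of Fourier coefficients of `(b + z a)⁻¹`, then `a * G (-1)` is
an idempotent. -/
theorem isIdempotent_of_fourier_relations {a b : B} {G : ℤ → B} {C : ℝ}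
    (hl : ∀ k, b * G k + a * G (k - 1) = if k = 0 then 1 else 0)
    (hr : ∀ k, G k * b + G (k - 1) * a = if k = 0 then 1 else 0)
    (hC : ∀ k, ‖G k‖ ≤ C) (hG : Tendsto (fun k : ℕ => G k) atTop (𝓝 0)) :
    a * G (-1) * (a * G (-1)) = a * G (-1) := by
  -- Off index `0` the relations read `b G(j) = -a G(j - 1)` and `G(j) b = -G(j - 1) a`. Using one
  -- on each side moves the indices apart by one step without changing the product, which must be
  -- `0` since `G k → 0` while `G` is bounded.
  have hstep : ∀ k : ℕ, G 0 * b * G (-1) = G k * b * G (-(k : ℤ) - 1) := by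
    intro k
    induction k with
    | zero => simp
    | succ k ih =>
      have h1 := hl (-(k : ℤ) - 1)
      have h2 := hr (k + 1)
      rw [if_neg (by omega)] at h1 h2
      rw [add_sub_cancel_right] at h2
      rw [ih, mul_assoc, eq_neg_of_add_eq_zero_left h1]
      push_cast
      rw [eq_neg_of_add_eq_zero_left h2, neg_add', neg_mul, mul_neg, mul_assoc]
  have h0 : G 0 * b * G (-1) = 0 := by
    have hlim : Tendsto (fun k : ℕ => ‖G k‖ * ‖b‖ * C) atTop (𝓝 0) := by
      simpa using (hG.norm.mul_const ‖b‖).mul_const C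
    refine tendsto_nhds_unique (tendsto_const_nhds (f := (atTop : Filter ℕ))) ?_
    refine squeeze_zero_norm (fun k => ?_) hlim
    rw [hstep k]
    refine (norm_mul_le _ _).trans ?_
    gcongr
    · exact norm_mul_le _ _
    · exact hC _
  have h1 := hr 0
  rw [if_pos rfl, zero_sub] at h1
  calc a * G (-1) * (a * G (-1)) = a * (G (-1) * a) * G (-1) := by simp only [mul_assoc]
    _ = a * (1 - G 0 * b) * G (-1) := by rw [eq_sub_of_add_eq' h1]
    _ = a * G (-1) - a * (G 0 * b * G (-1)) := by noncomm_ring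
    _ = a * G (-1) := by rw [h0, mul_zero, sub_zero]

/-- The point `e ^ (2πit)` of the unit circle. -/
noncomputable def unitCircleExp (t : ℝ) : ℂ := Complex.exp (2 * Real.pi * Complex.I * t)

theorem unitCircleExp_add (s t : ℝ) :
    unitCircleExp (s + t) = unitCircleExp s * unitCircleExp t := by
  simp only [unitCircleExp, ← Complex.exp_add]
  push_cast
  ring_nf

theorem unitCircleExp_zero : unitCircleExp 0 = 1 := by simp [unitCircleExp]

theorem unitCircleExp_int (k : ℤ) : unitCircleExp k = 1 := by
  rw [unitCircleExp, Complex.exp_eq_one_iff]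
  exact ⟨k, by push_cast; ring⟩

theorem norm_unitCircleExp (t : ℝ) : ‖unitCircleExp t‖ = 1 := by
  rw [unitCircleExp, Complex.norm_exp]
  simp

theorem unitCircleExp_ne_zero (t : ℝ) : unitCircleExp t ≠ 0 := Complex.exp_ne_zero _

theorem unitCircleExp_nat_mul (k : ℕ) (t : ℝ) :
    unitCircleExp (k * t) = unitCircleExp t ^ k := by
  simp only [unitCircleExp, ← Complex.exp_nat_mul]
  push_cast
  ring_nf

theorem exists_unitCircleExp_eq {z : ℂ} (hz : ‖z‖ = 1) :
    ∃ t ∈ Icc (0 : ℝ) 1, unitCircleExp t = z := by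
  have key : ∃ s : ℝ, unitCircleExp s = z := by
    refine ⟨Complex.arg z / (2 * Real.pi), ?_⟩
    have h := Complex.norm_mul_exp_arg_mul_I z
    rw [hz, Complex.ofReal_one, one_mul] at h
    rw [unitCircleExp]
    refine Eq.trans ?_ h
    congr 1
    push_cast
    field_simp
  obtain ⟨s, hs⟩ := key
  refine ⟨Int.fract s, ⟨Int.fract_nonneg s, (Int.fract_lt_one s).le⟩, ?_⟩
  have h := unitCircleExp_add (⌊s⌋ : ℝ) (Int.fract s)
  rwa [Int.floor_add_fract, unitCircleExp_int, one_mul, hs, eq_comm] at h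

/-- The frequency `c` is real so that integer Fourier modes and the negative powers `z^(-N)` are
treated alike. -/
theorem hasDerivAt_unitCircleExp_mul (c t : ℝ) :
    HasDerivAt (fun t => unitCircleExp (c * t))
      (2 * Real.pi * Complex.I * c * unitCircleExp (c * t)) t := by
  have h : HasDerivAt (fun t : ℝ => 2 * Real.pi * Complex.I * ((c * t : ℝ) : ℂ))
      (2 * Real.pi * Complex.I * c) t := by
    have h1 := ((hasDerivAt_id t).const_mul c).ofReal_comp.const_mul (2 * Real.pi * Complex.I)
    simpa using h1
  simpa [unitCircleExp, mul_comm] using h.cexp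

theorem hasDerivAt_unitCircleExp (t : ℝ) :
    HasDerivAt unitCircleExp (2 * Real.pi * Complex.I * unitCircleExp t) t := by
  simpa using hasDerivAt_unitCircleExp_mul 1 t

@[fun_prop]
theorem continuous_unitCircleExp : Continuous unitCircleExp := by
  unfold unitCircleExp
  fun_prop

theorem integral_unitCircleExp_mul (k : ℤ) :
    ∫ t in (0 : ℝ)..1, unitCircleExp (k * t) = if k = 0 then 1 else 0 := by
  split_ifs with hk
  · simp [hk, unitCircleExp_zero]
  · have hc : (2 * Real.pi * Complex.I * (k : ℝ) : ℂ) ≠ 0 := by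
      simp [hk, Real.pi_ne_zero]
    have h := intervalIntegral.integral_eq_sub_of_hasDerivAt (a := 0) (b := 1)
      (fun t _ => (hasDerivAt_unitCircleExp_mul k t).const_mul
        (2 * Real.pi * Complex.I * (k : ℝ) : ℂ)⁻¹)
      (Continuous.intervalIntegrable (by fun_prop) _ _)
    simp only [inv_mul_cancel_left₀ hc] at h
    rw [h]
    simp [unitCircleExp_zero, unitCircleExp_int]

/-- The Riemann–Lebesgue lemma for `R` cut off to `(0, 1]`. Integrability is not needed because a
non-integrable function has integral `0` by convention. -/
theorem tendsto_fourierCoeff_atTop (R : ℝ → B) :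
    Tendsto (fun k : ℕ => ∫ t in (0 : ℝ)..1, unitCircleExp (-((k : ℤ) : ℝ) * t) • R t) atTop
      (𝓝 0) := by
  have h := (Real.tendsto_integral_exp_smul_cocompact (indicator (Ioc 0 1) R)).comp
    (atTop_le_cocompact.trans' tendsto_natCast_atTop_atTop)
  refine h.congr fun k => ?_
  rw [intervalIntegral.integral_of_le zero_le_one, ← integral_indicator measurableSet_Ioc]
  refine integral_congr_ae (ae_of_all _ fun t => ?_)
  by_cases ht : t ∈ Ioc (0 : ℝ) 1
  · simp only [indicator_of_mem ht]
    rw [Circle.smul_def, Real.fourierChar_apply, unitCircleExp]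
    congr 2
    push_cast
    ring
  · simp [indicator_of_notMem ht]

/-- The Riesz projection of an invertible linear pencil `b + z a` on the unit circle. -/
theorem exists_idempotent_of_linear_pencil [CompleteSpace E] (T : B →L[ℂ] E) {a b : B}
    {u : ℝ → Bˣ} (hu : ∀ t, (u t).1 = b + unitCircleExp t • a) :
    ∃ p : B, p * p = p ∧
      ∫ t in (0 : ℝ)..1, unitCircleExp t • T (a * ((u t)⁻¹).1) = T p := by
  have hcu : Continuous fun t => ((u t)⁻¹).1 := by
    rw [← continuousOn_univ]
    refine continuousOn_inv_units ?_
    simp only [hu]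
    fun_prop
  -- The Fourier coefficients of the resolvent `(b + z a)⁻¹`. Comparing coefficients in `(b + z a)(b
  -- + z a)⁻¹ = 1`, and in the opposite order, gives the relations on `G`; the coefficient at `-1`
  -- is `(2πi)⁻¹ ∮ (b + z a)⁻¹ dz`.
  let G : ℤ → B := fun k => ∫ t in (0 : ℝ)..1, unitCircleExp (-(k : ℝ) * t) • ((u t)⁻¹).1
  have hint : ∀ k : ℤ, IntervalIntegrable
      (fun t => unitCircleExp (-(k : ℝ) * t) • ((u t)⁻¹).1) volume 0 1 := fun k =>
    Continuous.intervalIntegrable (by fun_prop) _ _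
  have hleft : ∀ (x : B) (k : ℤ),
      x * G k = ∫ t in (0 : ℝ)..1, x * (unitCircleExp (-(k : ℝ) * t) • ((u t)⁻¹).1) :=
    fun x k => ((ContinuousLinearMap.mul ℂ B x).intervalIntegral_comp_comm (hint k)).symm
  have hright : ∀ (x : B) (k : ℤ),
      G k * x = ∫ t in (0 : ℝ)..1, (unitCircleExp (-(k : ℝ) * t) • ((u t)⁻¹).1) * x :=
    fun x k => (((ContinuousLinearMap.mul ℂ B).flip x).intervalIntegral_comp_comm (hint k)).symm
  have hshift : ∀ (k : ℤ) (t : ℝ), unitCircleExp (-((k - 1 : ℤ) : ℝ) * t) =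
      unitCircleExp (-(k : ℝ) * t) * unitCircleExp t := fun k t => by
    rw [← unitCircleExp_add]
    push_cast
    ring_nf
  have hdelta : ∀ k : ℤ, ∫ t in (0 : ℝ)..1, unitCircleExp (-(k : ℝ) * t) • (1 : B) =
      if k = 0 then 1 else 0 := fun k => by
    have h := integral_unitCircleExp_mul (-k)
    rw [intervalIntegral.integral_smul_const]
    push_cast at h
    rw [h]
    simp [ite_smul]
  have hP : ∀ t, unitCircleExp t • T (a * ((u t)⁻¹).1) =
      T (a * (unitCircleExp (-((-1 : ℤ) : ℝ) * t) • ((u t)⁻¹).1)) := fun t => by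
    simp
  refine ⟨a * G (-1), ?_, ?_⟩
  · obtain ⟨C, hC⟩ := isCompact_Icc.exists_bound_of_continuousOn (s := Icc (0 : ℝ) 1)
      hcu.continuousOn
    refine isIdempotent_of_fourier_relations (b := b) (C := C) (fun k => ?_) (fun k => ?_)
      (fun k => ?_) (tendsto_fourierCoeff_atTop _)
    · rw [hleft, hleft, ← intervalIntegral.integral_add, ← hdelta k]
      · refine intervalIntegral.integral_congr fun t _ => ?_
        simp only [hshift]
        rw [← (u t).mul_inv, hu]
        simp only [mul_smul_comm, add_mul, smul_add, smul_mul_assoc, mul_smul]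
      all_goals exact Continuous.intervalIntegrable (by fun_prop) _ _
    · rw [hright, hright, ← intervalIntegral.integral_add, ← hdelta k]
      · refine intervalIntegral.integral_congr fun t _ => ?_
        simp only [hshift]
        rw [← (u t).inv_mul, hu]
        simp only [mul_smul_comm, mul_add, smul_add, smul_mul_assoc, mul_smul]
      all_goals exact Continuous.intervalIntegrable (by fun_prop) _ _
    · have h := intervalIntegral.norm_integral_le_of_norm_le_const (a := (0 : ℝ)) (b := 1)
        (f := fun t => unitCircleExp (-(k : ℝ) * t) • ((u t)⁻¹).1) (C := C) fun t ht => by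
          rw [norm_smul, norm_unitCircleExp, one_mul]
          rw [uIoc_of_le zero_le_one] at ht
          exact hC t (Ioc_subset_Icc_self ht)
      simpa only [sub_zero, abs_one, mul_one] using h
  · simp only [hP]
    rw [hleft]
    exact T.intervalIntegral_comp_comm (Continuous.intervalIntegrable (by fun_prop) _ _)

end RieszProjection

/-! ### Polynomials in Horner form, which exposes the constant coefficient used in linearization. -/

section HornerPolynomial

/-- The value at `z` of the polynomial `a 0 + z a 1 + ⋯ + z ^ d a d`. -/
def hornerEval {M : Type*} [AddCommGroup M] [Module ℂ M] : ℕ → (ℕ → M) → ℂ → M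
  | 0, a, _ => a 0
  | d + 1, a, z => a 0 + z • hornerEval d (fun k => a (k + 1)) z

/-- The derivative at `z` of the polynomial `a 0 + z a 1 + ⋯ + z ^ d a d`. -/
def hornerDeriv {M : Type*} [AddCommGroup M] [Module ℂ M] : ℕ → (ℕ → M) → ℂ → M
  | 0, _, _ => 0
  | d + 1, a, z => hornerEval d (fun k => a (k + 1)) z + z • hornerDeriv d (fun k => a (k + 1)) z

theorem hornerEval_eq_sum {M : Type*} [AddCommGroup M] [Module ℂ M] (d : ℕ) (a : ℕ → M) (z : ℂ) :
    hornerEval d a z = ∑ k ∈ Finset.range (d + 1), z ^ k • a k := by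
  induction d generalizing a with
  | zero => simp [hornerEval]
  | succ d ih =>
    rw [hornerEval, ih, Finset.sum_range_succ' _ (d + 1), Finset.smul_sum, add_comm]
    simp [smul_smul, pow_succ']

theorem hasDerivAt_hornerEval {B : Type*} [NormedAddCommGroup B] [NormedSpace ℂ B] (d : ℕ)
    (a : ℕ → B) (z : ℂ) : HasDerivAt (hornerEval d a) (hornerDeriv d a z) z := by
  induction d generalizing a with
  | zero => exact hasDerivAt_const z (a 0)
  | succ d ih =>
    have h := ((hasDerivAt_id z).smul (ih fun k => a (k + 1))).const_add (a 0)
    refine h.congr_deriv ?_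
    simp [hornerDeriv, add_comm]

theorem continuous_hornerDeriv {B : Type*} [NormedAddCommGroup B] [NormedSpace ℂ B] (d : ℕ)
    (a : ℕ → B) : Continuous (hornerDeriv d a) := by
  induction d generalizing a with
  | zero => exact continuous_const
  | succ d ih =>
    have h : Continuous (hornerEval d fun k => a (k + 1)) :=
      continuous_iff_continuousAt.2 fun z => (hasDerivAt_hornerEval d _ z).continuousAt
    have h' := ih fun k => a (k + 1)
    change Continuous fun z => hornerEval d (fun k => a (k + 1)) z +
      z • hornerDeriv d (fun k => a (k + 1)) z
    fun_prop

variable {R : Type*} [Ring R] [Module ℂ R] {ι κ : Type*}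

theorem hornerEval_fromBlocks (d : ℕ) (a : ℕ → Matrix ι ι R) (b : ℕ → Matrix ι κ R)
    (c : ℕ → Matrix κ ι R) (e : ℕ → Matrix κ κ R) (z : ℂ) :
    hornerEval d (fun k => Matrix.fromBlocks (a k) (b k) (c k) (e k)) z =
      Matrix.fromBlocks (hornerEval d a z) (hornerEval d b z) (hornerEval d c z)
        (hornerEval d e z) := by
  induction d generalizing a b c e with
  | zero => rfl
  | succ d ih => simp only [hornerEval, ih, Matrix.fromBlocks_smul, Matrix.fromBlocks_add]

theorem hornerDeriv_fromBlocks (d : ℕ) (a : ℕ → Matrix ι ι R) (b : ℕ → Matrix ι κ R)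
    (c : ℕ → Matrix κ ι R) (e : ℕ → Matrix κ κ R) (z : ℂ) :
    hornerDeriv d (fun k => Matrix.fromBlocks (a k) (b k) (c k) (e k)) z =
      Matrix.fromBlocks (hornerDeriv d a z) (hornerDeriv d b z) (hornerDeriv d c z)
        (hornerDeriv d e z) := by
  induction d generalizing a b c e with
  | zero => simp [hornerDeriv]
  | succ d ih =>
    simp only [hornerDeriv, ih, hornerEval_fromBlocks, Matrix.fromBlocks_smul,
      Matrix.fromBlocks_add]

variable {M : Type*} [AddCommGroup M] [Module ℂ M]

theorem hornerEval_zero (d : ℕ) (z : ℂ) : hornerEval d (fun _ => (0 : M)) z = 0 := by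
  simp [hornerEval_eq_sum]

theorem hornerDeriv_zero (d : ℕ) (z : ℂ) : hornerDeriv d (fun _ => (0 : M)) z = 0 := by
  induction d with
  | zero => rfl
  | succ d ih => simp [hornerDeriv, hornerEval_zero, ih]

theorem hornerEval_single_zero (d : ℕ) (x : M) (z : ℂ) :
    hornerEval d (Pi.single 0 x) z = x := by
  rw [hornerEval_eq_sum, Finset.sum_eq_single 0] <;> simp +contextual

theorem Pi.single_one_succ (x : M) :
    (fun k : ℕ => (Pi.single 1 x : ℕ → M) (k + 1)) = Pi.single 0 x := by
  ext k; simp [Pi.single_apply]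

theorem hornerDeriv_single_zero (d : ℕ) (x : M) (z : ℂ) :
    hornerDeriv d (Pi.single 0 x) z = 0 := by
  cases d with
  | zero => rfl
  | succ d => simp [hornerDeriv, hornerEval_zero, hornerDeriv_zero]

/-- The degree has to be positive for the coefficient at index `1` to be counted. -/
theorem hornerEval_single_one (d : ℕ) (x : M) (z : ℂ) :
    hornerEval (d + 1) (Pi.single 1 x) z = z • x := by
  simp [hornerEval, Pi.single_one_succ, hornerEval_single_zero]

theorem hornerDeriv_single_one (d : ℕ) (x : M) (z : ℂ) :
    hornerDeriv (d + 1) (Pi.single 1 x) z = x := by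
  simp [hornerDeriv, Pi.single_one_succ, hornerEval_single_zero, hornerDeriv_single_zero]

end HornerPolynomial

/-! ### Traces on matrix algebras, and linearization of matrix polynomials. -/

section MatrixNorm

open scoped Matrix.Norms.Operator

/-- The operator norm induces the product uniformity, that of a finite power of `A`. -/
instance Matrix.completeSpace_linftyOp {A : Type*} [NormedRing A] [CompleteSpace A] {ι : Type*}
    [Fintype ι] [DecidableEq ι] :
    @CompleteSpace (Matrix ι ι A) PseudoMetricSpace.toUniformSpace :=
  inferInstanceAs (CompleteSpace (ι → ι → A))

variable {A E : Type*} [NormedRing A] [NormedAlgebra ℂ A]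
  [NormedAddCommGroup E] [NormedSpace ℂ E]

theorem traceExt_add (τ : A →L[ℂ] E) {ι : Type*} [Fintype ι] (x y : Matrix ι ι A) :
    traceExt τ (x + y) = traceExt τ x + traceExt τ y := by
  simp [traceExt, Finset.sum_add_distrib]

theorem traceExt_smul (τ : A →L[ℂ] E) {ι : Type*} [Fintype ι] (c : ℂ) (x : Matrix ι ι A) :
    traceExt τ (c • x) = c • traceExt τ x := by
  simp [traceExt, Finset.smul_sum]

/-- Continuous linear maps on a normed algebra, for the structures derived from its norm. -/
abbrev NormedAlgebra.CLM (B E : Type*) [NormedRing B] [NormedAlgebra ℂ B] [NormedAddCommGroup E]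
    [NormedSpace ℂ E] : Type _ := B →L[ℂ] E

/-- The extension of `τ` to square matrices, as a continuous linear map. -/
noncomputable def traceCLM (τ : A →L[ℂ] E) (ι : Type*) [Fintype ι] [DecidableEq ι] :
    NormedAlgebra.CLM (Matrix ι ι A) E where
  toFun := traceExt τ
  map_add' := traceExt_add τ
  map_smul' := traceExt_smul τ
  cont := by
    change Continuous fun x : Matrix ι ι A => ∑ j, τ (x j j)
    fun_prop

theorem traceCLM_apply (τ : A →L[ℂ] E) {ι : Type*} [Fintype ι] [DecidableEq ι]
    (x : Matrix ι ι A) : traceCLM τ ι x = traceExt τ x := rfl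

theorem traceCLM_mul_comm (τ : A →L[ℂ] E) (hτ : ∀ x y, τ (y * x) = τ (x * y)) (ι : Type*)
    [Fintype ι] [DecidableEq ι] (x y : Matrix ι ι A) :
    traceCLM τ ι (x * y) = traceCLM τ ι (y * x) := traceExt_mul_comm τ hτ x y

theorem traceExt_fromBlocks (τ : A →L[ℂ] E) {ι κ : Type*} [Fintype ι] [Fintype κ]
    (a : Matrix ι ι A) (b : Matrix ι κ A) (c : Matrix κ ι A) (d : Matrix κ κ A) :
    traceExt τ (Matrix.fromBlocks a b c d) = traceExt τ a + traceExt τ d := by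
  simp [traceExt]

theorem traceExt_reindex (τ : A →L[ℂ] E) {ι κ : Type*} [Fintype ι] [Fintype κ] (s : ι ≃ κ)
    (x : Matrix ι ι A) : traceExt τ (Matrix.reindex s s x) = traceExt τ x := by
  simp only [traceExt, Matrix.reindex_apply, Matrix.submatrix_apply]
  exact s.symm.sum_comp fun i => τ (x i i)

/-- The trace of an idempotent matrix belongs to the image of `K₀`. -/
theorem traceExt_mem_range_traceK0 (τ : A →L[ℂ] E) (hτ : ∀ x y, τ (y * x) = τ (x * y))
    {ι : Type*} [Fintype ι] {p : Matrix ι ι A} (hp : p * p = p) :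
    traceExt τ p ∈ (traceK0 τ hτ).range := by
  let s := Fintype.equivFin ι
  refine ⟨K0.cls ⟨_, Matrix.reindex s s p, ?_⟩, ?_⟩
  · rw [Matrix.reindex_apply, Matrix.submatrix_mul_equiv, hp]
  · rw [traceK0_cls]
    exact traceExt_reindex τ s p

variable [CompleteSpace A]

section Linearization
variable {ι : Type} [Fintype ι] [DecidableEq ι]

/-- The coefficients of the linearization `[[a 0, (q - a 0) / z], [-z, 1]]` of the polynomial `q`
with coefficients `a`. -/
noncomputable def linearizationCoeff (a : ℕ → Matrix ι ι A) (k : ℕ) : Matrix (ι ⊕ ι) (ι ⊕ ι) A :=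
  Matrix.fromBlocks ((Pi.single 0 (a 0) : ℕ → Matrix ι ι A) k) (a (k + 1))
    ((Pi.single 1 (-1) : ℕ → Matrix ι ι A) k) ((Pi.single 0 1 : ℕ → Matrix ι ι A) k)

theorem hornerEval_linearizationCoeff (a : ℕ → Matrix ι ι A) (d : ℕ) (z : ℂ) :
    hornerEval (d + 1) (linearizationCoeff a) z =
      Matrix.fromBlocks (a 0) (hornerEval (d + 1) (fun k => a (k + 1)) z) (-(z • 1)) 1 := by
  unfold linearizationCoeff
  rw [hornerEval_fromBlocks, hornerEval_single_zero, hornerEval_single_zero,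
    hornerEval_single_one, smul_neg]

theorem hornerDeriv_linearizationCoeff (a : ℕ → Matrix ι ι A) (d : ℕ) (z : ℂ) :
    hornerDeriv (d + 1) (linearizationCoeff a) z =
      Matrix.fromBlocks 0 (hornerDeriv (d + 1) (fun k => a (k + 1)) z) (-1) 0 := by
  unfold linearizationCoeff
  rw [hornerDeriv_fromBlocks, hornerDeriv_single_zero, hornerDeriv_single_zero,
    hornerDeriv_single_one]

/-- With `u = a 0 + z q`, the linearization factors as `[[1, q], [0, 1]] · diag(u, 1) · [[1, 0],
[-z, 1]]`. It is invertible exactly as `u` is, and the unipotent factors contribute nothing to the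
trace of the logarithmic derivative. -/
theorem exists_unit_linearization (τ : A →L[ℂ] E) (hτ : ∀ x y, τ (y * x) = τ (x * y))
    (a : ℕ → Matrix ι ι A) (d : ℕ) (z : ℂ)
    (u : (Matrix ι ι A)ˣ) (hu : u.1 = hornerEval (d + 2) a z) :
    ∃ v : (Matrix (ι ⊕ ι) (ι ⊕ ι) A)ˣ, v.1 = hornerEval (d + 1) (linearizationCoeff a) z ∧
      traceExt τ (hornerDeriv (d + 1) (linearizationCoeff a) z * (v⁻¹).1) =
        traceExt τ (hornerDeriv (d + 2) a z * (u⁻¹).1) := by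
  have huq : u.1 = a 0 + z • hornerEval (d + 1) (fun k => a (k + 1)) z := hu
  have h1 : u.1 * (u⁻¹).1 = 1 := u.mul_inv
  have h2 : (u⁻¹).1 * u.1 = 1 := u.inv_mul
  rw [hornerEval_linearizationCoeff, hornerDeriv_linearizationCoeff]
  change ∃ v : (Matrix (ι ⊕ ι) (ι ⊕ ι) A)ˣ, _ ∧ _ = traceExt τ
    ((hornerEval (d + 1) (fun k => a (k + 1)) z +
      z • hornerDeriv (d + 1) (fun k => a (k + 1)) z) * (u⁻¹).1)
  generalize hornerEval (d + 1) (fun k => a (k + 1)) z = q at *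
  generalize hornerDeriv (d + 1) (fun k => a (k + 1)) z = q' at *
  have ha : a 0 = u.1 - z • q := eq_sub_of_add_eq huq.symm
  have h3 : z • (q * (u⁻¹).1) = 1 - a 0 * (u⁻¹).1 := by
    rw [ha, sub_mul, h1, smul_mul_assoc, sub_sub_cancel]
  have h4 : z • ((u⁻¹).1 * q) = 1 - (u⁻¹).1 * a 0 := by
    rw [ha, mul_sub, h2, mul_smul_comm, sub_sub_cancel]
  -- The inverse is `[[1, 0], [z, 1]] · diag(u⁻¹, 1) · [[1, -q], [0, 1]]`, multiplied out.
  refine ⟨⟨Matrix.fromBlocks (a 0) q (-(z • 1)) 1,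
    Matrix.fromBlocks (u⁻¹).1 (-((u⁻¹).1 * q)) (z • (u⁻¹).1) (1 - z • ((u⁻¹).1 * q)),
    ?_, ?_⟩, rfl, ?_⟩
  · rw [Matrix.fromBlocks_multiply, ← Matrix.fromBlocks_one]
    congr 1
    · rw [mul_smul_comm, h3]; abel
    · rw [mul_sub, mul_smul_comm, ← mul_assoc q, ← smul_mul_assoc, h3]; noncomm_ring
    · simp
    · simp
  · rw [Matrix.fromBlocks_multiply, ← Matrix.fromBlocks_one]
    congr 1
    · rw [mul_neg, mul_smul_comm, mul_one, smul_neg, neg_neg, h4]; abel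
    · simp
    · rw [h4, sub_sub_cancel, smul_mul_assoc, mul_neg, mul_smul_comm, mul_one, add_neg_cancel]
    · rw [smul_mul_assoc]; simp
  · change traceExt τ (_ * Matrix.fromBlocks _ _ _ _) = _
    rw [Matrix.fromBlocks_multiply, traceExt_fromBlocks, add_mul]
    rw [traceExt_add τ (q * _), traceExt_mul_comm τ hτ q]
    simp [add_comm]

end Linearization

/-- The logarithmic derivative of a matrix polynomial which is invertible on the unit circle
integrates to the trace of an idempotent. -/
theorem integral_logDeriv_polynomial_mem_range [CompleteSpace E] (τ : A →L[ℂ] E)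
    (hτ : ∀ x y, τ (y * x) = τ (x * y)) (d : ℕ) {ι : Type} [Fintype ι] [DecidableEq ι]
    (a : ℕ → Matrix ι ι A) (u : ℝ → (Matrix ι ι A)ˣ)
    (hu : ∀ t, (u t).1 = hornerEval (d + 1) a (unitCircleExp t)) :
    ∫ t in (0 : ℝ)..1, unitCircleExp t • traceExt τ
      (hornerDeriv (d + 1) a (unitCircleExp t) * ((u t)⁻¹).1) ∈ (traceK0 τ hτ).range := by
  induction d generalizing ι with
  | zero =>
    obtain ⟨p, hp, h⟩ := exists_idempotent_of_linear_pencil (traceCLM τ ι) (a := a 1) (b := a 0)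
      (u := u) hu
    have h0 : ∀ z, hornerDeriv (0 + 1) a z = a 1 := fun z => by
      simp [hornerDeriv, hornerEval]
    simp only [h0]
    exact h ▸ traceExt_mem_range_traceK0 τ hτ hp
  | succ d ih =>
    -- One degree is traded for a doubling of the index type, which is why the induction runs over
    -- all `ι`.
    choose v hv hv' using fun t => exists_unit_linearization τ hτ a d (unitCircleExp t) (u t) (hu t)
    have h := ih (linearizationCoeff a) v hv
    have hcongr := intervalIntegral.integral_congr (μ := volume) (a := (0 : ℝ)) (b := 1)
      fun t _ => congrArg (unitCircleExp t • ·) (hv' t)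
    exact hcongr ▸ h

end MatrixNorm

/-! ### Uniform approximation of loops by trigonometric polynomials. -/

section TrigonometricApproximation

variable {B : Type*} [NormedAddCommGroup B] [NormedSpace ℂ B]

/-- The trigonometric polynomial `∑ e ^ (2πikt) c k`. -/
noncomputable def trigPoly (c : ℤ →₀ B) (t : ℝ) : B :=
  c.sum fun k b => unitCircleExp (k * t) • b

theorem trigPoly_add (c c' : ℤ →₀ B) (t : ℝ) :
    trigPoly (c + c') t = trigPoly c t + trigPoly c' t :=
  Finsupp.sum_add_index' (fun _ => smul_zero _) fun _ => smul_add _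

/-- Uniform approximability by trigonometric polynomials on `[0, 1]`. -/
def TrigApproximable (f : ℝ → B) : Prop :=
  ∀ ε > 0, ∃ c : ℤ →₀ B, ∀ t ∈ Icc (0 : ℝ) 1, ‖f t - trigPoly c t‖ < ε

theorem TrigApproximable.const (b : B) : TrigApproximable fun _ => b := fun ε hε =>
  ⟨Finsupp.single 0 b, fun t _ => by simpa [trigPoly, unitCircleExp_zero] using hε⟩

theorem TrigApproximable.add {f g : ℝ → B} (hf : TrigApproximable f) (hg : TrigApproximable g) :
    TrigApproximable fun t => f t + g t := fun ε hε => by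
  obtain ⟨c, hc⟩ := hf (ε / 2) (half_pos hε)
  obtain ⟨c', hc'⟩ := hg (ε / 2) (half_pos hε)
  refine ⟨c + c', fun t ht => ?_⟩
  rw [trigPoly_add, add_sub_add_comm]
  linarith [norm_add_le (f t - trigPoly c t) (g t - trigPoly c' t), hc t ht, hc' t ht]

theorem TrigApproximable.finset_sum {ι : Type*} (s : Finset ι) {f : ι → ℝ → B}
    (hf : ∀ i ∈ s, TrigApproximable (f i)) : TrigApproximable fun t => ∑ i ∈ s, f i t := by
  classical
  induction s using Finset.induction_on with
  | empty => simpa using TrigApproximable.const (0 : B)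
  | insert i s hi ih =>
    simp only [Finset.sum_insert hi]
    exact (hf i (Finset.mem_insert_self i s)).add
      (ih fun j hj => hf j (Finset.mem_insert_of_mem hj))

theorem TrigApproximable.of_forall_exists {f : ℝ → B}
    (h : ∀ ε > 0, ∃ g, TrigApproximable g ∧ ∀ t ∈ Icc (0 : ℝ) 1, ‖f t - g t‖ < ε) :
    TrigApproximable f := fun ε hε => by
  obtain ⟨g, hg, hfg⟩ := h (ε / 2) (half_pos hε)
  obtain ⟨c, hc⟩ := hg (ε / 2) (half_pos hε)
  refine ⟨c, fun t ht => ?_⟩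
  linarith [norm_sub_le_norm_sub_add_norm_sub (f t) (g t) (trigPoly c t), hfg t ht, hc t ht]

/-- A closed path descends to the circle, where the Fourier monomials span a dense subspace of the
continuous functions. -/
theorem trigApproximable_scalar {g : ℝ → ℂ} (hg : ContinuousOn g (Icc 0 1)) (h01 : g 0 = g 1) :
    TrigApproximable g := fun ε hε => by
  have : Fact ((0 : ℝ) < 1) := ⟨zero_lt_one⟩
  let G : C(AddCircle (1 : ℝ), ℂ) :=
    ⟨AddCircle.liftIco 1 0 g, AddCircle.liftIco_zero_continuous h01 hg⟩
  have hG : G ∈ (Submodule.span ℂ (range (fourier (T := (1 : ℝ))))).topologicalClosure := by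
    rw [span_fourier_closure_eq_top]
    trivial
  obtain ⟨p, hp, hdist⟩ := Metric.mem_closure_iff.1 hG ε hε
  obtain ⟨c, rfl⟩ := Finsupp.mem_span_range_iff_exists_finsupp.1 hp
  refine ⟨c, fun t ht => ?_⟩
  have h1 : G (t : AddCircle (1 : ℝ)) = g t := by
    rcases ht.2.eq_or_lt with rfl | hlt
    · have h2 : ((1 : ℝ) : AddCircle (1 : ℝ)) = ((0 : ℝ) : AddCircle (1 : ℝ)) := by
        simp [AddCircle.coe_period]
      rw [h2, ← h01]
      exact AddCircle.liftIco_zero_coe_apply ⟨le_rfl, zero_lt_one⟩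
    · exact AddCircle.liftIco_zero_coe_apply ⟨ht.1, hlt⟩
  have h2 := (ContinuousMap.dist_apply_le_dist (t : AddCircle (1 : ℝ))).trans_lt hdist
  have h3 : (c.sum fun i a => a • fourier i) (t : AddCircle (1 : ℝ)) = trigPoly c t := by
    simp only [trigPoly, Finsupp.sum, ContinuousMap.coe_sum, Finset.sum_apply]
    refine Finset.sum_congr rfl fun k _ => ?_
    rw [ContinuousMap.smul_apply, fourier_coe_apply, smul_eq_mul, smul_eq_mul, mul_comm,
      unitCircleExp]
    congr 2
    push_cast
    ring
  rwa [dist_eq_norm, h1, h3] at h2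

theorem TrigApproximable.smul_const {g : ℝ → ℂ} (hg : TrigApproximable g) (b : B) :
    TrigApproximable fun t => g t • b := fun ε hε => by
  obtain ⟨c, hc⟩ := hg (ε / (‖b‖ + 1)) (by positivity)
  refine ⟨c.mapRange (· • b) (zero_smul ℂ b), fun t ht => ?_⟩
  have h : trigPoly (c.mapRange (· • b) (zero_smul ℂ b)) t = trigPoly c t • b := by
    rw [trigPoly, Finsupp.sum_mapRange_index fun _ => smul_zero _, trigPoly, Finsupp.sum,
      Finsupp.sum, Finset.sum_smul]
    simp [smul_smul]
  rw [h, ← sub_smul, norm_smul]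
  have h1 := hc t ht
  rw [lt_div_iff₀ (by positivity)] at h1
  nlinarith [norm_nonneg (g t - trigPoly c t)]

/-- Uniform approximation of continuous closed paths by trigonometric polynomials. -/
theorem trigApproximable_of_continuousOn {f : ℝ → B} (hf : ContinuousOn f (Icc 0 1))
    (h01 : f 0 = f 1) : TrigApproximable f := by
  -- Vector values are reduced to scalar ones by Bernstein approximation. Once `f` vanishes at both
  -- ends, the terms `k = 0` and `k = n` drop out, and the other Bernstein polynomials vanish at `0`
  -- and `1`, hence are closed scalar paths.
  suffices h : TrigApproximable fun t => f t - f 0 by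
    simpa using h.add (TrigApproximable.const (f 0))
  refine TrigApproximable.of_forall_exists fun ε hε => ?_
  let F : C(unitInterval, B) := ⟨fun t => f t - f 0,
    (continuousOn_iff_continuous_domRestrict.1 hf).sub continuous_const⟩
  obtain ⟨n, hn0, hn⟩ := ((Filter.eventually_ne_atTop 0).and
    (Metric.tendsto_nhds.1 (bernsteinApproximation_uniform F) ε hε)).exists
  let β : ℕ → ℝ → ℂ := fun k t => ((n.choose k * t ^ k * (1 - t) ^ (n - k) : ℝ) : ℂ)
  refine ⟨fun t => ∑ k : Fin (n + 1), β k t • F (bernstein.z k),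
    TrigApproximable.finset_sum _ fun k _ => ?_, fun t ht => ?_⟩
  · by_cases hk : k.1 = 0 ∨ k.1 = n
    · have hF : F (bernstein.z k) = 0 := by
        rcases hk with hk | hk
        · have h0 : bernstein.z k = 0 := by simp [bernstein.z, hk]
          rw [h0]
          exact sub_self (f 0)
        · simp [F, bernstein.z, hk, hn0, h01]
      simpa [hF] using TrigApproximable.const (0 : B)
    · push Not at hk
      refine TrigApproximable.smul_const (trigApproximable_scalar ?_ ?_) _
      · exact Continuous.continuousOn (by fun_prop)
      · have hk' : n - k.1 ≠ 0 := by have := k.2; omega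
        simp [β, hk.1, hk']
  · have h := (ContinuousMap.dist_apply_le_dist (⟨t, ht⟩ : unitInterval)).trans_lt hn
    rw [dist_comm, dist_eq_norm, bernsteinApproximation.apply] at h
    refine lt_of_eq_of_lt (congrArg _ (congrArg _ (Finset.sum_congr rfl fun k _ => ?_))) h
    rw [bernstein_apply]
    exact Complex.coe_smul _ _

theorem exists_trigPoly_eq_hornerEval (c : ℤ →₀ B) : ∃ (N d : ℕ) (a : ℕ → B), ∀ t,
    trigPoly c t = unitCircleExp (-(N : ℝ) * t) • hornerEval (d + 1) a (unitCircleExp t) := by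
  let N : ℕ := ∑ k ∈ c.support, k.natAbs
  have hN : ∀ k ∈ c.support, k.natAbs ≤ N := fun k hk =>
    Finset.single_le_sum (f := Int.natAbs) (fun _ _ => Nat.zero_le _) hk
  -- The frequencies lie in `[-N, N]`, so shifting by `N` makes them nonnegative. The degree is `2N
  -- + 1`, one more than necessary, so that it is positive; the extra coefficient `c (N + 1)` is
  -- `0`.
  refine ⟨N, 2 * N, fun j => c (j - N), fun t => ?_⟩
  have hinj : InjOn (fun j : ℕ => (j : ℤ) - N) (Finset.range (2 * N + 1 + 1)) := fun x _ y _ h => by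
    simpa using h
  rw [hornerEval_eq_sum, trigPoly, Finset.smul_sum]
  have h1 : ∀ j ∈ Finset.range (2 * N + 1 + 1),
      unitCircleExp (-(N : ℝ) * t) • unitCircleExp t ^ j • c (j - N) =
        unitCircleExp (((j - N : ℤ) : ℝ) * t) • c (j - N) := fun j _ => by
    rw [smul_smul, ← unitCircleExp_nat_mul, ← unitCircleExp_add]
    congr 2
    push_cast
    ring
  rw [Finset.sum_congr rfl h1,
    ← Finset.sum_image (g := fun j : ℕ => (j : ℤ) - N)
      (f := fun k : ℤ => unitCircleExp (k * t) • c k) hinj]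
  refine Finset.sum_subset (fun k hk => ?_) fun k _ hk => by
    simp [Finsupp.notMem_support_iff.1 hk]
  have := hN k hk
  exact Finset.mem_image.2 ⟨(k + N).toNat, Finset.mem_range.2 (by omega), by omega⟩

end TrigonometricApproximation

/-! ### Replacing a loop of units by a polynomial loop. -/

section ClosedPaths

variable {B E : Type*} [NormedRing B] [NormedAlgebra ℂ B] [CompleteSpace B]
  [NormedAddCommGroup E] [NormedSpace ℂ E]

theorem trigPoly_zero_eq_one (c : ℤ →₀ B) : trigPoly c 0 = trigPoly c 1 := by
  simp only [trigPoly, mul_zero, mul_one, unitCircleExp_zero, unitCircleExp_int]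

theorem isUnit_of_norm_sub_lt (u : Bˣ) {x : B} (h : ‖(u⁻¹).1 * (u.1 - x)‖ < 1) : IsUnit x := by
  have h1 : x = u.1 * (1 - (u⁻¹).1 * (u.1 - x)) := by
    rw [mul_sub, mul_one, u.mul_inv_cancel_left, sub_sub_cancel]
  rw [h1]
  exact u.isUnit.mul (isUnit_one_sub_of_norm_lt_one h)

theorem hasDerivAt_hornerEval_unitCircleExp (d : ℕ) (a : ℕ → B) (t : ℝ) :
    HasDerivAt (fun t => hornerEval d a (unitCircleExp t))
      ((2 * Real.pi * Complex.I * unitCircleExp t) • hornerDeriv d a (unitCircleExp t)) t :=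
  (hasDerivAt_hornerEval d a _).scomp t (hasDerivAt_unitCircleExp t)

theorem isPiecewiseDifferentiable_hornerEval (d : ℕ) (a : ℕ → B) :
    IsPiecewiseDifferentiable (fun t => hornerEval d a (unitCircleExp t)) 0 1 := by
  have h := (continuous_hornerDeriv d a).comp continuous_unitCircleExp
  refine .of_hasDerivAt_continuous zero_le_one (hasDerivAt_hornerEval_unitCircleExp d a) ?_
  fun_prop

theorem logDerivIntegral_hornerEval (T : B →L[ℂ] E) {d : ℕ} {a : ℕ → B} {u : ℝ → Bˣ}
    (hu : ∀ t, (u t).1 = hornerEval d a (unitCircleExp t)) :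
    logDerivIntegral T u 0 1 = (2 * Real.pi * Complex.I : ℂ) •
      ∫ t in (0 : ℝ)..1, unitCircleExp t • T (hornerDeriv d a (unitCircleExp t) * ((u t)⁻¹).1) := by
  rw [logDerivIntegral, ← intervalIntegral.integral_smul]
  refine intervalIntegral.integral_congr fun t _ => ?_
  simp only [hu, (hasDerivAt_hornerEval_unitCircleExp d a t).deriv]
  rw [smul_mul_assoc, map_smul, smul_smul]

/-- The scalar unit `e ^ (2πict)`. -/
noncomputable def scalarRotation (B : Type*) [NormedRing B] [NormedAlgebra ℂ B] (c t : ℝ) : Bˣ :=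
  Units.map (algebraMap ℂ B).toMonoidHom (Units.mk0 _ (unitCircleExp_ne_zero (c * t)))

theorem scalarRotation_val (c t : ℝ) :
    (scalarRotation B c t).1 = unitCircleExp (c * t) • (1 : B) :=
  Algebra.algebraMap_eq_smul_one _

theorem scalarRotation_inv_val (c t : ℝ) :
    ((scalarRotation B c t)⁻¹).1 = (unitCircleExp (c * t))⁻¹ • (1 : B) :=
  Algebra.algebraMap_eq_smul_one _

theorem hasDerivAt_scalarRotation (c t : ℝ) :
    HasDerivAt (fun t => (scalarRotation B c t).1)
      ((2 * Real.pi * Complex.I * c * unitCircleExp (c * t)) • (1 : B)) t := by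
  simp only [scalarRotation_val]
  exact (hasDerivAt_unitCircleExp_mul c t).smul_const 1

theorem isPiecewiseDifferentiable_scalarRotation (c : ℝ) :
    IsPiecewiseDifferentiable (fun t => (scalarRotation B c t).1) 0 1 :=
  .of_hasDerivAt_continuous zero_le_one (hasDerivAt_scalarRotation c) (by fun_prop)

theorem logDerivIntegral_scalarRotation [CompleteSpace E] (T : B →L[ℂ] E) (c : ℝ) :
    logDerivIntegral T (scalarRotation B c) 0 1 = (2 * Real.pi * Complex.I * c : ℂ) • T 1 := by
  have h : ∀ t : ℝ, T (deriv (fun s => (scalarRotation B c s).1) t *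
      ((scalarRotation B c t)⁻¹).1) = (2 * Real.pi * Complex.I * c : ℂ) • T 1 := fun t => by
    rw [(hasDerivAt_scalarRotation c t).deriv, scalarRotation_inv_val, smul_mul_smul_comm,
      mul_assoc _ (unitCircleExp _), mul_inv_cancel₀ (unitCircleExp_ne_zero _), mul_one, mul_one,
      map_smul]
  simp [logDerivIntegral, h]

/-- The logarithmic derivative integral of a closed path agrees with that of a Laurent polynomial
in `e ^ (2πit)`. -/
theorem exists_logDerivIntegral_eq_polynomial [CompleteSpace E] (T : B →L[ℂ] E)
    (hT : ∀ x y, T (x * y) = T (y * x)) {f : ℝ → Bˣ}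
    (hf : IsPiecewiseDifferentiable (fun t => (f t).1) 0 1) (h01 : f 0 = f 1) :
    ∃ (N d : ℕ) (a : ℕ → B) (u : ℝ → Bˣ),
      (∀ t, (u t).1 = hornerEval (d + 1) a (unitCircleExp t)) ∧
      (2 * Real.pi * Complex.I : ℂ)⁻¹ • logDerivIntegral T f 0 1 =
        (∫ t in (0 : ℝ)..1, unitCircleExp t •
          T (hornerDeriv (d + 1) a (unitCircleExp t) * ((u t)⁻¹).1)) - N • T 1 := by
  obtain ⟨C, hC⟩ := isCompact_Icc.exists_bound_of_continuousOn (continuousOn_inv_units hf.1)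
  have hC0 : 0 ≤ C := (norm_nonneg _).trans (hC 0 ⟨le_rfl, zero_le_one⟩)
  -- As `C` bounds `f⁻¹`, this tolerance gives `‖f⁻¹ (f - p)‖ ≤ C / (C + 1) < 1`, also when `C = 0`.
  obtain ⟨c, hc⟩ := trigApproximable_of_continuousOn hf.1 (congrArg Units.val h01) (C + 1)⁻¹
    (by positivity)
  obtain ⟨N, d, a, ha⟩ := exists_trigPoly_eq_hornerEval c
  have hlt : ∀ t ∈ Icc (0 : ℝ) 1, ‖((f t)⁻¹).1 * ((f t).1 - trigPoly c t)‖ < 1 := fun t ht => by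
    refine (norm_mul_le _ _).trans_lt ?_
    have h1 := hC t ht
    have h2 := hc t ht
    calc _ ≤ C * ‖(f t).1 - trigPoly c t‖ := by gcongr
      _ ≤ C * (C + 1)⁻¹ := by gcongr
      _ < 1 := by
        rw [mul_inv_lt_iff₀ (by positivity)]
        linarith
  -- The estimate is known only on `[0, 1]`, but this interval already covers the whole circle.
  have hunit : ∀ t, IsUnit (hornerEval (d + 1) a (unitCircleExp t)) := fun t => by
    obtain ⟨s, hs, hst⟩ := exists_unitCircleExp_eq (norm_unitCircleExp t)
    have h1 := isUnit_of_norm_sub_lt (f s) (hlt s hs)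
    have h2 := (scalarRotation B (-N) s)⁻¹.isUnit.mul h1
    rwa [scalarRotation_inv_val, smul_mul_assoc, one_mul, ha, smul_smul,
      inv_mul_cancel₀ (unitCircleExp_ne_zero _), one_smul, hst] at h2
  choose u hu using hunit
  refine ⟨N, d, a, u, hu, ?_⟩
  have hpd : IsPiecewiseDifferentiable (fun t => (u t).1) 0 1 := by
    simpa only [hu] using isPiecewiseDifferentiable_hornerEval (d + 1) a
  let g : ℝ → Bˣ := fun t => scalarRotation B (-N) t * u t
  have hgval : ∀ t, (g t).1 = trigPoly c t := fun t => by
    simp only [g, Units.val_mul, scalarRotation_val, hu, ha, smul_mul_assoc, one_mul]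
  have hgpd : IsPiecewiseDifferentiable (fun t => (g t).1) 0 1 :=
    (isPiecewiseDifferentiable_scalarRotation _).mul zero_le_one hpd
  -- `1 - f⁻¹ g = f⁻¹ (f - p)` has norm less than `1`, so the loop `f⁻¹ g` has a logarithm under the
  -- trace.
  have hW : logDerivIntegral T (fun t => (f t)⁻¹ * g t) 0 1 = 0 := by
    refine logDerivIntegral_eq_zero_of_norm_lt_one T hT zero_le_one
      ((hf.units_inv zero_le_one).mul zero_le_one hgpd) ?_ fun t ht => ?_
    · have hg01 : g 0 = g 1 := Units.ext (by rw [hgval, hgval, trigPoly_zero_eq_one])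
      simp only [h01, hg01]
    · have h := hlt t ht
      rwa [mul_sub, Units.inv_mul, ← hgval] at h
  rw [logDerivIntegral_mul T hT zero_le_one (hf.units_inv zero_le_one) hgpd,
    logDerivIntegral_inv T hT zero_le_one hf, neg_add_eq_zero] at hW
  rw [hW, logDerivIntegral_mul T hT zero_le_one (isPiecewiseDifferentiable_scalarRotation _) hpd,
    logDerivIntegral_scalarRotation, logDerivIntegral_hornerEval T hu, smul_add,
    inv_smul_smul₀ Complex.two_pi_I_ne_zero, smul_smul, ← mul_assoc,
    inv_mul_cancel₀ Complex.two_pi_I_ne_zero, add_comm, one_mul]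
  push_cast
  rw [neg_smul, Nat.cast_smul_eq_nsmul, sub_eq_add_neg]

end ClosedPaths

/-! ### Loops of invertible matrices and `K₀`. -/

section MatrixClosedPaths

open scoped Matrix.Norms.Operator

/-- The logarithmic derivative of a closed path in `GL_n(A)` integrates, up to the factor `2πi`,
to an element of the image of `K₀(A)`. -/
theorem logDerivIntegral_mem_range_traceK0 {A E : Type*} [NormedRing A] [NormedAlgebra ℂ A]
    [CompleteSpace A] [NormedAddCommGroup E] [NormedSpace ℂ E] [CompleteSpace E] (τ : A →L[ℂ] E)
    (hτ : ∀ x y, τ (y * x) = τ (x * y)) {ι : Type} [Fintype ι] [DecidableEq ι]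
    {f : ℝ → (Matrix ι ι A)ˣ} (hf : IsPiecewiseDifferentiable (fun t => (f t).1) 0 1)
    (h01 : f 0 = f 1) :
    (2 * Real.pi * Complex.I : ℂ)⁻¹ • logDerivIntegral (traceCLM τ ι) f 0 1 ∈
      (traceK0 τ hτ).range := by
  obtain ⟨N, d, a, u, hu, h⟩ := exists_logDerivIntegral_eq_polynomial (traceCLM τ ι)
    (traceCLM_mul_comm τ hτ ι) hf h01
  rw [h]
  exact sub_mem (integral_logDeriv_polynomial_mem_range τ hτ d a u hu)
    (nsmul_mem (traceExt_mem_range_traceK0 τ hτ (mul_one 1)) N)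

end MatrixClosedPaths

/-! ### Paths in `GL_∞(A)` and the values of the determinant. -/

section MatrixPaths

open scoped Matrix.Norms.Operator

variable {A E : Type*} [NormedRing A] [NormedAlgebra ℂ A]
  [NormedAddCommGroup E] [NormedSpace ℂ E]

/-- The `(i, j)` entry of a matrix, as a continuous linear map. -/
noncomputable def entryCLM {ι : Type*} [Fintype ι] [DecidableEq ι] (i j : ι) :
    Matrix ι ι A →L[ℝ] A where
  toFun x := x i j
  map_add' _ _ := rfl
  map_smul' _ _ := rfl
  cont := by fun_prop

/-- The matrix with a single nonzero entry, as a continuous linear map. -/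
noncomputable def singleCLM {ι : Type*} [Fintype ι] [DecidableEq ι] (i j : ι) :
    A →L[ℝ] Matrix ι ι A where
  toFun := Matrix.single i j
  map_add' := Matrix.single_add i j
  map_smul' c x := (Matrix.smul_single c i j x).symm
  cont := by
    refine continuous_matrix fun k l => ?_
    simp only [Matrix.single_apply]
    split_ifs <;> fun_prop

theorem isPiecewiseDifferentiable_matrix_iff {ι : Type*} [Fintype ι] [DecidableEq ι]
    {f : ℝ → Matrix ι ι A} {a b : ℝ} (hab : a ≤ b) :
    IsPiecewiseDifferentiable f a b ↔
      ∀ i j, IsPiecewiseDifferentiable (fun t => f t i j) a b := by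
  refine ⟨fun h i j => h.clm_comp hab (entryCLM i j), fun h => ?_⟩
  have h1 : f = fun t => ∑ i, ∑ j, singleCLM i j (f t i j) :=
    funext fun t => Matrix.matrix_eq_sum_single (f t)
  rw [h1]
  exact .finset_sum hab _ fun i _ => .finset_sum hab _ fun j _ =>
    (h i j).clm_comp hab (singleCLM i j)

theorem deriv_matrix_apply {ι : Type*} [Fintype ι] [DecidableEq ι] {f : ℝ → Matrix ι ι A} {t : ℝ}
    (hf : DifferentiableAt ℝ f t) (i j : ι) :
    deriv (fun s => f s i j) t = deriv f t i j :=
  ((entryCLM (A := A) i j).hasFDerivAt.comp_hasDerivAt t hf.hasDerivAt).deriv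

/-- The entrywise velocity is the matrix derivative wherever the path is differentiable, hence off a
finite set. -/
theorem deltaTilde_eq_logDerivIntegral [CompleteSpace A] (τ : A →L[ℂ] E) (ξ : PiecewisePath A) :
    deltaTilde τ ξ = (2 * Real.pi * Complex.I : ℂ)⁻¹ •
      logDerivIntegral (traceCLM τ (Fin ξ.level)) ξ.toFun ξ.left ξ.right := by
  have hf := (isPiecewiseDifferentiable_matrix_iff (f := fun t => (ξ.toFun t).1) ξ.le).2
    ξ.piecewise
  obtain ⟨S, hS, hd⟩ := hf.2.1
  rw [deltaTilde, logDerivIntegral]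
  congr 1
  refine intervalIntegral_congr_of_forall_Ioo_diff ξ.le hS fun t ht => ?_
  have h : ξ.velocity t = deriv (fun s => (ξ.toFun s).1) t := by
    ext i j
    exact deriv_matrix_apply (hd t ht) i j
  rw [h]
  rfl

section Padding

/-- The inclusion `x ↦ diag(x, 0)` of matrix algebras, as a continuous linear map. -/
noncomputable def matPadCLM (A : Type*) [NormedRing A] [NormedAlgebra ℂ A] (n m : ℕ) :
    Matrix (Fin n) (Fin n) A →L[ℝ] Matrix (Fin m) (Fin m) A where
  toFun := matPad m
  map_add' := matPad_add m
  map_smul' c x := by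
    ext i j
    simp only [matPad, Matrix.of_apply, Matrix.smul_apply, RingHom.id_apply]
    split_ifs <;> simp
  cont := by
    change Continuous fun x : Matrix (Fin n) (Fin n) A => matPad m x
    simp only [matPad_eq]
    fun_prop

theorem traceExt_matPad (τ : A →L[ℂ] E) (hτ : ∀ x y, τ (y * x) = τ (x * y)) {n m : ℕ}
    (h : n ≤ m) (x : Matrix (Fin n) (Fin n) A) : traceExt τ (matPad m x) = traceExt τ x := by
  rw [matPad_eq, traceExt_mul_comm τ hτ, ← Matrix.mul_assoc, rectOne_mul (Or.inl h), rectOne_self,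
    Matrix.one_mul]

theorem glPad_injective {n m : ℕ} (h : n ≤ m) : Function.Injective (glPad (R := A) h) := by
  intro u v huv
  have h1 := congrArg Units.val huv
  simp only [glPad_val, matPadOne, add_left_inj, matPad_eq] at h1
  have h2 := congrArg (fun x => rectOne A n m * x * rectOne A m n) h1
  have h3 : rectOne A n m * rectOne A m n = 1 := by rw [rectOne_mul (Or.inl h), rectOne_self]
  simp only [Matrix.mul_assoc, h3, Matrix.mul_one] at h2
  simp only [← Matrix.mul_assoc, h3, Matrix.one_mul] at h2
  exact Units.ext h2

/-- Allows equalities of endpoints in `GL_∞` to be read off in `GL_n`, without enlarging `n`. -/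
theorem toGLInf_injective (n : ℕ) : Function.Injective (toGLInf (R := A) n) :=
  DirectLimit.mk_injective (fun _ _ h => glPad (R := A) h) (fun _ _ h => glPad_injective h) n

theorem hasDerivAt_glPad {n m : ℕ} (h : n ≤ m) {f : ℝ → (Matrix (Fin n) (Fin n) A)ˣ}
    {f' : Matrix (Fin n) (Fin n) A} {t : ℝ} (hf : HasDerivAt (fun t => (f t).1) f' t) :
    HasDerivAt (fun t => (glPad h (f t)).1) (matPad m f') t :=
  ((matPadCLM A n m).hasFDerivAt.comp_hasDerivAt t hf).add_const _

theorem isPiecewiseDifferentiable_glPad {n m : ℕ} (h : n ≤ m)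
    {f : ℝ → (Matrix (Fin n) (Fin n) A)ˣ} {a b : ℝ} (hab : a ≤ b)
    (hf : IsPiecewiseDifferentiable (fun t => (f t).1) a b) :
    IsPiecewiseDifferentiable (fun t => (glPad h (f t)).1) a b := by
  obtain ⟨S, hS, hd⟩ := hf.2.1
  have hi := hf.2.2
  exact .of_hasDerivAt hab ((continuous_matPadOne m).comp_continuousOn hf.1) hS
    (fun t ht => hasDerivAt_glPad h (hd t ht).hasDerivAt)
    ⟨(matPadCLM A n m).integrable_comp hi.1, (matPadCLM A n m).integrable_comp hi.2⟩

/-- The derivative is padded by `0`, which annihilates the identity block padding the inverse. -/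
theorem logDerivIntegral_glPad (τ : A →L[ℂ] E) (hτ : ∀ x y, τ (y * x) = τ (x * y)) {n m : ℕ}
    (h : n ≤ m) {f : ℝ → (Matrix (Fin n) (Fin n) A)ˣ} {a b : ℝ} (hab : a ≤ b)
    (hf : IsPiecewiseDifferentiable (fun t => (f t).1) a b) :
    logDerivIntegral (traceCLM τ (Fin m)) (fun t => glPad h (f t)) a b =
      logDerivIntegral (traceCLM τ (Fin n)) f a b := by
  obtain ⟨S, hS, hd⟩ := hf.2.1
  refine intervalIntegral_congr_of_forall_Ioo_diff hab hS fun t ht => ?_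
  rw [(hasDerivAt_glPad h (hd t ht).hasDerivAt).deriv, ← map_inv, glPad_val]
  have h1 : ∀ x y : Matrix (Fin n) (Fin n) A, matPad m x * matPadOne m y = matPad m (x * y) :=
    fun x y => by
      rw [matPadOne, mul_add, mul_sub, mul_one, ← matPad_mul h, ← matPad_mul h, mul_one, sub_self,
        add_zero]
  rw [h1]
  exact traceExt_matPad τ hτ h _

end Padding

variable [CompleteSpace A]

theorem toGLInf_mem_of_path {n : ℕ} {f : ℝ → (Matrix (Fin n) (Fin n) A)ˣ} {a b : ℝ}
    (hf : IsPiecewiseDifferentiable (fun t => (f t).1) a b) (h0 : toGLInf n (f a) = 1) :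
    ∀ t ∈ Icc a b, toGLInf n (f t) ∈ GLInfZero A := fun t ht => by
  have hc : ContinuousOn (fun t => toGLInf n (f t)) (Icc a b) :=
    (continuous_toGLInf n).comp_continuousOn (continuousOn_units_iff.2 hf.1)
  exact (isPreconnected_Icc.image _ hc).subset_connectedComponent
    ⟨a, ⟨le_rfl, ht.1.trans ht.2⟩, h0⟩ ⟨t, ht, rfl⟩

/-- `e` is the value of `deltaTilde` on some path `[0, 1] → GL_∞(A)` from `1` to `x`. -/
def IsDeltaValue (τ : A →L[ℂ] E) (x : GLInf A) (e : E) : Prop :=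
  ∃ (n : ℕ) (f : ℝ → (Matrix (Fin n) (Fin n) A)ˣ),
    IsPiecewiseDifferentiable (fun t => (f t).1) 0 1 ∧ f 0 = 1 ∧ toGLInf n (f 1) = x ∧
    (2 * Real.pi * Complex.I : ℂ)⁻¹ • logDerivIntegral (traceCLM τ (Fin n)) f 0 1 = e

theorem IsDeltaValue.mem {τ : A →L[ℂ] E} {x : GLInf A} {e : E} (h : IsDeltaValue τ x e) :
    x ∈ GLInfZero A := by
  obtain ⟨n, f, hf, h0, rfl, -⟩ := h
  exact toGLInf_mem_of_path hf (by rw [h0, map_one]) 1 ⟨zero_le_one, le_rfl⟩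

theorem PiecewisePath.isDeltaValue (τ : A →L[ℂ] E) {ξ : PiecewisePath A} (h : ξ.source = 1) :
    IsDeltaValue τ (ξ.target : GLInf A) (deltaTilde τ ξ) := by
  have hf := (isPiecewiseDifferentiable_matrix_iff (f := fun t => (ξ.toFun t).1) ξ.le).2
    ξ.piecewise
  refine ⟨ξ.level, fun t => ξ.toFun ((ξ.right - ξ.left) * t + ξ.left), hf.comp_affine ξ.le, ?_,
    ?_, ?_⟩
  · refine toGLInf_injective _ ?_
    rw [map_one]
    simpa [PiecewisePath.source, Subtype.ext_iff] using h
  · simp [PiecewisePath.target]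
  · rw [logDerivIntegral_comp_affine, deltaTilde_eq_logDerivIntegral]

theorem IsDeltaValue.exists_path {τ : A →L[ℂ] E} {x : GLInfZero A} {e : E}
    (h : IsDeltaValue τ (x : GLInf A) e) :
    ∃ ξ : PiecewisePath A, ξ.source = 1 ∧ ξ.target = x ∧ deltaTilde τ ξ = e := by
  obtain ⟨n, f, hf, h0, h1, rfl⟩ := h
  have h0' : toGLInf n (f 0) = 1 := by rw [h0, map_one]
  refine ⟨⟨0, 1, zero_le_one, n, f, toGLInf_mem_of_path hf h0',
    (isPiecewiseDifferentiable_matrix_iff zero_le_one).1 hf⟩, Subtype.ext h0', Subtype.ext h1, ?_⟩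
  rw [deltaTilde_eq_logDerivIntegral]

/-- Serves to bring two paths to a common matrix size before multiplying them. -/
theorem IsDeltaValue.exists_level {τ : A →L[ℂ] E} (hτ : ∀ x y, τ (y * x) = τ (x * y))
    {x : GLInf A} {e : E} (h : IsDeltaValue τ x e) : ∃ n, ∀ m, n ≤ m →
    ∃ f : ℝ → (Matrix (Fin m) (Fin m) A)ˣ,
      IsPiecewiseDifferentiable (fun t => (f t).1) 0 1 ∧ f 0 = 1 ∧ toGLInf m (f 1) = x ∧
      (2 * Real.pi * Complex.I : ℂ)⁻¹ • logDerivIntegral (traceCLM τ (Fin m)) f 0 1 = e := by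
  obtain ⟨n, f, hf, h0, h1, rfl⟩ := h
  refine ⟨n, fun m hm => ⟨fun t => glPad hm (f t), isPiecewiseDifferentiable_glPad hm zero_le_one hf,
    ?_, ?_, ?_⟩⟩
  · simp only [h0, map_one]
  · rw [toGLInf_glPad, h1]
  · rw [logDerivIntegral_glPad τ hτ hm zero_le_one hf]

/-- The pointwise product of paths replaces concatenation; together with `IsDeltaValue.inv` it shows
that two values for one `x` differ by a value for `1`. -/
theorem IsDeltaValue.mul {τ : A →L[ℂ] E} (hτ : ∀ x y, τ (y * x) = τ (x * y)) {x y : GLInf A}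
    {e e' : E} (h : IsDeltaValue τ x e) (h' : IsDeltaValue τ y e') :
    IsDeltaValue τ (x * y) (e + e') := by
  obtain ⟨n, hn⟩ := h.exists_level hτ
  obtain ⟨n', hn'⟩ := h'.exists_level hτ
  obtain ⟨f, hf, f0, f1, rfl⟩ := hn _ (le_max_left n n')
  obtain ⟨g, hg, g0, g1, rfl⟩ := hn' _ (le_max_right n n')
  refine ⟨_, fun t => f t * g t, hf.mul zero_le_one hg, ?_, ?_, ?_⟩
  · simp only [f0, g0, one_mul]
  · rw [map_mul, f1, g1]
  · rw [logDerivIntegral_mul _ (traceCLM_mul_comm τ hτ _) zero_le_one hf hg, smul_add]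

theorem IsDeltaValue.inv {τ : A →L[ℂ] E} (hτ : ∀ x y, τ (y * x) = τ (x * y)) {x : GLInf A}
    {e : E} (h : IsDeltaValue τ x e) : IsDeltaValue τ x⁻¹ (-e) := by
  obtain ⟨n, f, hf, f0, f1, rfl⟩ := h
  refine ⟨n, fun t => (f t)⁻¹, hf.units_inv zero_le_one, ?_, ?_, ?_⟩
  · simp only [f0, inv_one]
  · rw [map_inv, f1]
  · rw [logDerivIntegral_inv _ (traceCLM_mul_comm τ hτ _) zero_le_one hf, smul_neg]

theorem IsDeltaValue.mem_range_traceK0 [CompleteSpace E] {τ : A →L[ℂ] E}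
    (hτ : ∀ x y, τ (y * x) = τ (x * y)) {e : E} (h : IsDeltaValue τ 1 e) :
    e ∈ (traceK0 τ hτ).range := by
  obtain ⟨n, f, hf, f0, f1, rfl⟩ := h
  refine logDerivIntegral_mem_range_traceK0 τ hτ hf ?_
  rw [f0]
  exact (toGLInf_injective n (by rw [f1, map_one])).symm

/-- The value is `τ` of the diagonal sum of the matrix-valued integral, since a continuous linear
map commutes with integration. -/
theorem IsDeltaValue.mem_range [CompleteSpace E] {τ : A →L[ℂ] E} {x : GLInf A} {e : E}
    (h : IsDeltaValue τ x e) : e ∈ range τ := by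
  obtain ⟨n, f, hf, f0, f1, rfl⟩ := h
  rw [logDerivIntegral_eq_apply _ zero_le_one hf, traceCLM_apply, traceExt, ← map_sum, ← map_smul]
  exact mem_range_self _

theorem deltaMap_eq_of_isDeltaValue [CompleteSpace E] {τ : A →L[ℂ] E}
    (hτ : ∀ x y, τ (y * x) = τ (x * y)) {x : GLInfZero A} {e : E}
    (h : IsDeltaValue τ (x : GLInf A) e) : deltaMap τ hτ x = QuotientAddGroup.mk e := by
  have hex : ∃ ξ : PiecewisePath A, ξ.source = 1 ∧ ξ.target = x := by
    obtain ⟨ξ, h1, h2, -⟩ := h.exists_path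
    exact ⟨ξ, h1, h2⟩
  rw [deltaMap, dif_pos hex]
  have h1 := PiecewisePath.isDeltaValue τ hex.choose_spec.1
  rw [hex.choose_spec.2] at h1
  refine QuotientAddGroup.eq.2 (IsDeltaValue.mem_range_traceK0 hτ ?_)
  simpa using (h1.inv hτ).mul hτ h

theorem exists_isDeltaValue_of_norm_lt_one (τ : A →L[ℂ] E) {n : ℕ}
    {w : (Matrix (Fin n) (Fin n) A)ˣ} (hw : ‖1 - w.1‖ < 1) :
    ∃ e, IsDeltaValue τ (toGLInf n w) e := by
  -- A smooth substitute for `t` on the segment from `1` to `w`: it takes values in `[0, 1]` for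
  -- every real `t`, so the path consists of units on all of `ℝ`.
  let φ : ℝ → ℝ := fun t => Real.sin (Real.pi / 2 * t) ^ 2
  have hunit : ∀ t, IsUnit (1 - φ t • (1 - w.1)) := fun t => by
    refine isUnit_one_sub_of_norm_lt_one (lt_of_le_of_lt ?_ hw)
    rw [norm_smul]
    refine mul_le_of_le_one_left (norm_nonneg _) ?_
    rw [Real.norm_of_nonneg (sq_nonneg _)]
    exact Real.sin_sq_le_one _
  choose f hf using hunit
  refine ⟨_, n, f, ?_, Units.ext ?_, congrArg _ (Units.ext ?_), rfl⟩
  · simp only [hf]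
    have h1 : ∀ t : ℝ, HasDerivAt φ (2 * Real.sin (Real.pi / 2 * t) *
        (Real.cos (Real.pi / 2 * t) * (Real.pi / 2))) t := fun t => by
      have h2 := (((hasDerivAt_id t).const_mul (Real.pi / 2)).sin).pow 2
      refine h2.congr_deriv ?_
      simp
    exact .of_hasDerivAt_continuous zero_le_one
      (fun t => ((h1 t).smul_const (1 - w.1)).const_sub 1) (by fun_prop)
  · simp [hf, φ]
  · simp [hf, φ]

/-- If `v` is close to `u` in `GL_n(A)`, then `v u⁻¹` is reached by a segment from `1`, so `u` is
reached if and only if `v` is. The reachable set is thus clopen for the inductive limit topology. -/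
theorem exists_isDeltaValue {τ : A →L[ℂ] E} (hτ : ∀ x y, τ (y * x) = τ (x * y)) {x : GLInf A}
    (hx : x ∈ GLInfZero A) : ∃ e, IsDeltaValue τ x e := by
  let H : Set (GLInf A) := {x | ∃ e, IsDeltaValue τ x e}
  have hnhds : ∀ (n : ℕ) (u : (Matrix (Fin n) (Fin n) A)ˣ),
      ∀ᶠ v in nhds u, ∃ e, IsDeltaValue τ (toGLInf n (v * u⁻¹)) e := fun n u => by
    have hc : Continuous fun v : (Matrix (Fin n) (Fin n) A)ˣ => ‖1 - (v * u⁻¹).1‖ :=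
      (continuous_const.sub (Units.continuous_val.comp (continuous_mul_const u⁻¹))).norm
    have h1 : ‖1 - (u * u⁻¹).1‖ < 1 := by simp
    filter_upwards [hc.continuousAt.eventually_lt continuousAt_const h1] with v hv
    exact exists_isDeltaValue_of_norm_lt_one τ hv
  have hopen : ∀ s : Set (GLInf A),
      (∀ n (u : (Matrix (Fin n) (Fin n) A)ˣ), toGLInf n u ∈ s →
        ∀ᶠ v in nhds u, toGLInf n v ∈ s) → IsOpen s := fun s hs => by
    rw [isOpen_iSup_iff]
    refine fun n => isOpen_coinduced.2 (isOpen_iff_mem_nhds.2 fun u hu => hs n u hu)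
  have hclopen : IsClopen H := by
    refine ⟨⟨hopen _ fun n u hu => ?_⟩, hopen _ fun n u hu => ?_⟩
    · filter_upwards [hnhds n u] with v ⟨e, he⟩ ⟨e', he'⟩
      refine hu ⟨-e + e', ?_⟩
      have h := (he.inv hτ).mul hτ he'
      rwa [← map_inv, ← map_mul, mul_inv_rev, inv_inv, inv_mul_cancel_right] at h
    · obtain ⟨e', he'⟩ := hu
      filter_upwards [hnhds n u] with v ⟨e, he⟩
      refine ⟨e + e', ?_⟩
      have h := he.mul hτ he'
      rwa [← map_mul, inv_mul_cancel_right] at h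
  have h1 : (1 : GLInf A) ∈ H := by
    obtain ⟨e, he⟩ := exists_isDeltaValue_of_norm_lt_one τ
      (w := (1 : (Matrix (Fin 0) (Fin 0) A)ˣ)) (by simp)
    exact ⟨e, by rwa [map_one] at he⟩
  exact hclopen.connectedComponent_subset h1 hx

theorem isDeltaValue_glExp {τ : A →L[ℂ] E} (hτ : ∀ x y, τ (y * x) = τ (x * y)) [CompleteSpace E]
    {n : ℕ} (y : Matrix (Fin n) (Fin n) A) :
    IsDeltaValue τ (toGLInf n (glExp y))
      ((2 * Real.pi * Complex.I : ℂ)⁻¹ • traceExt τ y) := by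
  have hd : ∀ t : ℝ, HasDerivAt (fun t : ℝ => (glExp (t • y)).1) ((glExp (t • y)).1 * y) t :=
    fun t => hasDerivAt_exp_smul_const y t
  refine ⟨n, fun t => glExp (t • y), ?_, Units.ext ?_, ?_, ?_⟩
  · refine .of_hasDerivAt_continuous zero_le_one hd ?_
    have hc : Continuous fun t : ℝ => (glExp (t • y)).1 :=
      continuous_iff_continuousAt.2 fun t => (hd t).continuousAt
    exact hc.mul continuous_const
  · simp [glExp]
  · simp only [one_smul]
  · exact congrArg _ (logDerivIntegral_of_hasDerivAt_mul _ (traceCLM_mul_comm τ hτ _) hd)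

/-- A homomorphism on `K₀` is determined by the classes `[e]`, and `τ(e)` is `τ` of the diagonal sum
of `e`; so the composite with `E → E / τ(A)` vanishes. -/
theorem range_traceK0_subset (τ : A →L[ℂ] E) (hτ : ∀ x y, τ (y * x) = τ (x * y)) :
    range (traceK0 τ hτ) ⊆ range τ := by
  have h : (QuotientAddGroup.mk' (τ : A →+ E).range).comp (traceK0 τ hτ) = 0 := by
    refine Algebra.GrothendieckAddGroup.lift.symm.injective (AddMonoidHom.ext ?_)
    rintro ⟨e⟩
    refine (QuotientAddGroup.eq_zero_iff _).2 ⟨∑ j, e.mat j j, ?_⟩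
    exact (map_sum τ _ _).trans (traceK0_cls τ hτ e).symm
  rintro _ ⟨x, rfl⟩
  exact (QuotientAddGroup.eq_zero_iff _).1 (DFunLike.congr_fun h x)

end MatrixPaths

/-! ### The determinant theorem. -/

theorem mainTheorem1 {A E : Type*} [NormedRing A] [NormedAlgebra ℂ A] [CompleteSpace A]
    [NormedAddCommGroup E] [NormedSpace ℂ E] [CompleteSpace E]
    (τ : A →L[ℂ] E) (hτ : ∀ x y, τ (y * x) = τ (x * y)) :
    (∀ x : GLInfZero A, ∃ ξ : PiecewisePath A, ξ.source = 1 ∧ ξ.target = x) ∧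
    (∀ ξ : PiecewisePath A, ξ.source = 1 →
      deltaMap τ hτ ξ.target = QuotientAddGroup.mk (deltaTilde τ ξ)) ∧
    (∀ x y : GLInfZero A, deltaMap τ hτ (x * y) = deltaMap τ hτ x + deltaMap τ hτ y) ∧
    (Set.range (traceK0 τ hτ) ⊆ Set.range τ ∧
      Set.range (deltaMap τ hτ) =
        (QuotientAddGroup.mk : E → E ⧸ (traceK0 τ hτ).range) '' Set.range τ) ∧
    (Function.Surjective τ → Function.Surjective (deltaMap τ hτ)) ∧
    (∀ (n : ℕ) (y : Matrix (Fin n) (Fin n) A), ∃ h : toGLInf n (glExp y) ∈ GLInfZero A,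
      deltaMap τ hτ ⟨toGLInf n (glExp y), h⟩ =
        QuotientAddGroup.mk ((2 * Real.pi * Complex.I : ℂ)⁻¹ • traceExt τ y)) := by
  have hexp : ∀ (n : ℕ) (y : Matrix (Fin n) (Fin n) A), ∃ h : toGLInf n (glExp y) ∈ GLInfZero A,
      deltaMap τ hτ ⟨toGLInf n (glExp y), h⟩ =
        QuotientAddGroup.mk ((2 * Real.pi * Complex.I : ℂ)⁻¹ • traceExt τ y) := fun n y =>
    ⟨(isDeltaValue_glExp hτ y).mem, deltaMap_eq_of_isDeltaValue hτ (isDeltaValue_glExp hτ y)⟩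
  have hrange : Set.range (deltaMap τ hτ) =
      (QuotientAddGroup.mk : E → E ⧸ (traceK0 τ hτ).range) '' Set.range τ := by
    refine Set.Subset.antisymm ?_ ?_
    · rintro _ ⟨x, rfl⟩
      obtain ⟨e, he⟩ := exists_isDeltaValue hτ x.2
      exact ⟨e, he.mem_range, (deltaMap_eq_of_isDeltaValue hτ he).symm⟩
    · rintro _ ⟨_, ⟨a, rfl⟩, rfl⟩
      -- The class of `τ(a)` is attained at `e^(2πia)`, an element of `GL_1(A)`.
      obtain ⟨h, h'⟩ := hexp 1 (Matrix.of fun _ _ => (2 * Real.pi * Complex.I : ℂ) • a)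
      refine ⟨_, h'.trans (congrArg _ ?_)⟩
      simp only [traceExt, Matrix.of_apply, Fin.sum_univ_one, map_smul]
      exact inv_smul_smul₀ Complex.two_pi_I_ne_zero _
  refine ⟨fun x => ?_, fun ξ hξ => ?_, fun x y => ?_, ⟨range_traceK0_subset τ hτ, hrange⟩,
    fun hsurj => ?_, hexp⟩
  · obtain ⟨e, he⟩ := exists_isDeltaValue hτ x.2
    obtain ⟨ξ, h1, h2, -⟩ := he.exists_path
    exact ⟨ξ, h1, h2⟩
  · exact deltaMap_eq_of_isDeltaValue hτ (PiecewisePath.isDeltaValue τ hξ)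
  · obtain ⟨e, he⟩ := exists_isDeltaValue hτ x.2
    obtain ⟨e', he'⟩ := exists_isDeltaValue hτ y.2
    rw [deltaMap_eq_of_isDeltaValue hτ he, deltaMap_eq_of_isDeltaValue hτ he',
      deltaMap_eq_of_isDeltaValue hτ (x := x * y) (he.mul hτ he')]
    rfl
  · rw [← Set.range_eq_univ, hrange, hsurj.range_eq, Set.image_univ]
    exact QuotientAddGroup.mk_surjective.range_eq
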